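/- Let $T>0$, $D=(0,1)$, let $(\Omega,\mathcal F,P)$ be a probability space, and let $W$ be a space-time white noise on $[0,T]\times D$, i.e. a centered Gaussian process $g\mapsto W(g)=\int_0^T\!\int_D g\,dW$ indexed by $L^2((0,T)\times D)$ with $\mathbb E[W(g)W(h)]=(g,h)_{L^2((0,T)\times D)}$. Let $\mu\in\mathbb R$ and let $\kappa\ge 1$ be an integer with $(\kappa-1)^2\pi^2\le\mu<\kappa^2\pi^2$. Write $(\cdot,\cdot)$ and $\|\cdot\|$ for the inner product and norm of $L^2(D)$. For integers $N_\star,J_\star\ge 1$ put $\Delta t=T/N_\star$, $\Delta x=1/J_\star$, $T_n=((n-1)\Delta t,n\Delta t)$ for $1\le n\le N_\star$, and let $\psi_1,\dots,\psi_{J_\star+1}$ be the hat functions (continuous, piecewise linear nodal basis) of the uniform partition of $[0,1]$ with mesh length $\Delta x$. Let $G_{i,j}=(\psi_j,\psi_i)$, $R_{n,i}=\int_{T_n}\!\int_D\psi_i(x)\,dW(t,x)$, and $$\widehat W(t,x)=\frac1{\Delta t}\sum_{n=1}^{N_\star}\mathbf 1_{T_n}(t)\sum_{\ell=1}^{J_\star+1}\Big(\sum_{m=1}^{J_\star+1}G^{-1}_{\ell,m}R_{n,m}\Big)\psi_\ell(x).$$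 Let $\widehat u$ be the solution of $$\partial_t\widehat u+\partial_x^4\widehat u+\mu\,\partial_x^2\widehat u=\partial_x\widehat W\ \text{ in }(0,T]\times D,\qquad \widehat u=\partial_x^2\widehat u=0\ \text{ on }(0,T]\times\partial D,\qquad \widehat u(0,\cdot)=0,$$ almost surely, in the following weak sense: almost surely $\widehat u\in C([0,T];L^2(D))$, $\widehat u(0)=0$, and for all $t\in[0,T]$ and all smooth $\varphi$ with $\varphi=\varphi''=0$ on $\partial D$, $$(\widehat u(t),\varphi)+\int_0^t(\widehat u(s),\varphi''''+\mu\varphi'')\,ds=\int_0^t(\partial_x\widehat W(s),\varphi)\,ds .$$ Let $\lambda_k=k\pi$, $\varepsilon_k(x)=\sqrt2\sin(\lambda_kx)$, $\dot H^4(D)=\{v\in L^2(D):\sum_{k\ge1}\lambda_k^8(v,\varepsilon_k)^2<\infty\}$ and $\Lambda_Bv=\partial^4v+\mu\,\partial^2v$ (generalized derivatives) for $v\in\dot H^4(D)$. For an integer $M\ge1$ put $\Delta\tau=T/M$, $\tau_m=m\Delta\tau$, and let $(\widehat U^m)_{m=0}^M$ be the Backward Euler time-discrete approximations of $\widehat u$: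 almost surely $\widehat U^0=0$ and, for $m=1,\dots,M$, $\widehat U^m\in\dot H^4(D)$ and $$\widehat U^m-\widehat U^{m-1}+\Delta\tau\,\Lambda_B\widehat U^m=\int_{\tau_{m-1}}^{\tau_m}\partial_x\widehat W\,ds\quad\text{in }L^2(D).$$ **Theorem.** There is a constant $C>0$, independent of $\Delta t$, $\Delta x$, $\Delta\tau$ and $\epsilon$, such that, whenever $\kappa=1$, or $\kappa\ge2$ and $\Delta\tau\,\mu^2<\tfrac14$, the errors $\widehat U^m-\widehat u(\tau_m,\cdot)$, $1\le m\le M$, belong to $L^2(\Omega;L^2(D))$ (after modification on a null set) and $$\max_{1\le m\le M}\Big(\mathbb E\big[\|\widehat U^m-\widehat u(\tau_m,\cdot)\|^2\big]\Big)^{1/2}\le C\,\omega_1(\Delta\tau,\epsilon)\,\Delta\tau^{\frac18-\epsilon}\qquad\text{for all }\epsilon\in(0,\tfrac18],$$ where $\omega_1(\Delta\tau,\epsilon)=\epsilon^{-1/2}+\Delta\tau^{\epsilon}\big(1+\Delta\tau^{7/4}+\Delta\tau^{3/4}\big)^{1/2}$. -/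

import Mathlib

open MeasureTheory ProbabilityTheory Set
open scoped RealInnerProductSpace

namespace CahnHilliardCook

noncomputable section

/-- The space interval `D = (0,1)`. -/
abbrev D : Set ℝ := Ioo 0 1

/-- The real Hilbert space `L²(D)`. -/
abbrev L2D : Type := Lp ℝ 2 (volume.restrict D)

/-- Lebesgue measure on the space-time cylinder `(0,T) × D`. -/
abbrev cylinder (T : ℝ) : Measure (ℝ × ℝ) := volume.restrict (Ioo 0 T ×ˢ D)

/-- Space-time white noise on `[0,T] × D`: the centered Gaussian process indexed by
`L²((0,T) × D)` whose covariance is the inner product of that space (the isonormal Gaussian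
process). For a deterministic `g`, the random variable `W g` is the stochastic integral
`∫∫ g dW`; for `g` the indicator of a Borel set `A` it is the noise `W(A)`. -/
structure IsWhiteNoise {Ω : Type*} [MeasurableSpace Ω] (P : Measure Ω) (T : ℝ)
    (W : Lp ℝ 2 (cylinder T) → Ω → ℝ) : Prop where
  gaussian : IsGaussianProcess W P
  mean_zero : ∀ g, ∫ ω, W g ω ∂P = 0
  covariance : ∀ g h, ∫ ω, W g ω * W h ω ∂P = ⟪g, h⟫

/-! ### Hat functions and the regularized noise -/

/-- The hat functions over the uniform partition `x_i = i / J`, `i = 0, …, J`, of `[0,1]`: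
on `[0,1]`, `hat J i` is continuous, affine between consecutive nodes, `1` at `x_i` and `0` at
the other nodes. -/
def hat (J : ℕ) (i : Fin (J + 1)) (x : ℝ) : ℝ := max 0 (1 - |J * x - i|)

/-- The Gram matrix `G_{i,j} = (ψ_j, ψ_i)` of the hat functions in `L²(D)`. -/
def gram (J : ℕ) : Matrix (Fin (J + 1)) (Fin (J + 1)) ℝ :=
  Matrix.of fun i j => ∫ x in D, hat J j x * hat J i x

/-- The open time cell `(n Δt, (n+1) Δt)` with `Δt = T / N`, for `n = 0, …, N - 1`. -/
def timeCell (T : ℝ) (N : ℕ) (n : Fin N) : Set ℝ :=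
  Ioo ((n : ℝ) * (T / N)) (((n : ℝ) + 1) * (T / N))

/-- The function `(t,x) ↦ 𝟙_{T_n}(t) ψ_i(x)`. -/
def cellHat (T : ℝ) (N J : ℕ) (n : Fin N) (i : Fin (J + 1)) (p : ℝ × ℝ) : ℝ :=
  (timeCell T N n).indicator 1 p.1 * hat J i p.2

theorem memLp_cellHat (T : ℝ) (N J : ℕ) (n : Fin N) (i : Fin (J + 1)) :
    MemLp (cellHat T N J n i) 2 (cylinder T) := by
  have : IsFiniteMeasure (cylinder T) := by
    refine ⟨?_⟩
    simp only [cylinder, Measure.restrict_apply_univ, Measure.volume_eq_prod, Measure.prod_prod,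
      Real.volume_Ioo]
    exact ENNReal.mul_lt_top ENNReal.ofReal_lt_top ENNReal.ofReal_lt_top
  have hm : Measurable (cellHat T N J n i) := by
    have h1 : Measurable ((timeCell T N n).indicator (1 : ℝ → ℝ)) :=
      measurable_one.indicator measurableSet_Ioo
    have h2 : Measurable (hat J i) := by
      unfold hat
      fun_prop
    exact (h1.comp measurable_fst).mul (h2.comp measurable_snd)
  refine MemLp.of_bound hm.aestronglyMeasurable 1 (Filter.Eventually.of_forall fun p => ?_)
  have h1 : |(timeCell T N n).indicator (1 : ℝ → ℝ) p.1| ≤ 1 := by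
    by_cases h : p.1 ∈ timeCell T N n <;> simp [h]
  have h2 : |hat J i p.2| ≤ 1 := by
    unfold hat
    rw [abs_of_nonneg (le_max_left _ _)]
    exact max_le zero_le_one (by linarith [abs_nonneg ((J : ℝ) * p.2 - (i : ℝ))])
  rw [cellHat, Real.norm_eq_abs, abs_mul]
  exact mul_le_one₀ h1 (abs_nonneg _) h2

/-- The random variables `R_{n,i} = ∫_{T_n} ∫_D ψ_i(x) dW(t,x)`. -/
def cellNoise {Ω : Type*} {T : ℝ} (W : Lp ℝ 2 (cylinder T) → Ω → ℝ) (N J : ℕ)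
    (n : Fin N) (i : Fin (J + 1)) (ω : Ω) : ℝ :=
  W ((memLp_cellHat T N J n i).toLp _) ω

/-- The regularized noise
`Ŵ(t,x) = (1/Δt) ∑_n 𝟙_{T_n}(t) ∑_ℓ (∑_m G⁻¹_{ℓ,m} R_{n,m}) ψ_ℓ(x)`, `Δt = T / N`. -/
def regNoise {Ω : Type*} {T : ℝ} (W : Lp ℝ 2 (cylinder T) → Ω → ℝ) (N J : ℕ)
    (ω : Ω) (t x : ℝ) : ℝ :=
  1 / (T / N) * ∑ n : Fin N, (timeCell T N n).indicator 1 t *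
    ∑ l : Fin (J + 1), (∑ m : Fin (J + 1), (gram J)⁻¹ l m * cellNoise W N J n m ω) * hat J l x

/-- `∂ₓŴ(t,x)`. As `Ŵ(t,·)` is piecewise affine on `[0,1]`, its generalized derivative is the
classical one, which exists off the finitely many nodes. -/
def dxRegNoise {Ω : Type*} {T : ℝ} (W : Lp ℝ 2 (cylinder T) → Ω → ℝ) (N J : ℕ)
    (ω : Ω) (t x : ℝ) : ℝ :=
  deriv (fun y => regNoise W N J ω t y) x

/-! ### The regularized parabolic problem -/

/-- Smooth functions `φ` with `φ = φ'' = 0` at both endpoints of `D`. -/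
structure IsTestFunction (φ : ℝ → ℝ) : Prop where
  smooth : ContDiff ℝ (⊤ : ℕ∞) φ
  left : φ 0 = 0
  right : φ 1 = 0
  left_two : iteratedDeriv 2 φ 0 = 0
  right_two : iteratedDeriv 2 φ 1 = 0

/-- `u` is a (weak) solution of
`∂ₜu + ∂ₓ⁴u + μ ∂ₓ²u = ∂ₓŴ` in `(0,T] × D`, `u = ∂ₓ²u = 0` on `∂D`, `u(0,·) = 0`,
almost surely: the paths are continuous with values in `L²(D)`, and for all test functions `φ`
and all `t ∈ [0,T]`,
`(u(t),φ) + ∫₀ᵗ (u(s), φ'''' + μ φ'') ds = ∫₀ᵗ (∂ₓŴ(s), φ) ds`. -/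
def IsRegSolution {Ω : Type*} [MeasurableSpace Ω] (P : Measure Ω) {T : ℝ}
    (W : Lp ℝ 2 (cylinder T) → Ω → ℝ) (μ : ℝ) (N J : ℕ) (u : ℝ → Ω → L2D) : Prop :=
  ∀ᵐ ω ∂P,
    ContinuousOn (fun t => u t ω) (Icc 0 T) ∧
    u 0 ω = 0 ∧
    ∀ φ : ℝ → ℝ, IsTestFunction φ → ∀ t ∈ Icc (0 : ℝ) T,
      (∫ x in D, u t ω x * φ x)
        + (∫ s in (0 : ℝ)..t, ∫ x in D,
            u s ω x * (iteratedDeriv 4 φ x + μ * iteratedDeriv 2 φ x))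
      = ∫ s in (0 : ℝ)..t, ∫ x in D, dxRegNoise W N J ω s x * φ x

/-! ### The elliptic operator and the Backward Euler approximations -/

/-- `λ_k = k π`. -/
def lam (k : ℕ) : ℝ := k * Real.pi

/-- `ε_k(x) = √2 sin(λ_k x)`. -/
def eps (k : ℕ) (x : ℝ) : ℝ := √2 * Real.sin (lam k * x)

/-- Membership in `Ḣ^m(D)`: `∑_{k ≥ 1} λ_k^{2m} (v, ε_k)² < ∞`. -/
def MemHdot (m : ℕ) (v : L2D) : Prop :=
  Summable fun k : ℕ => lam (k + 1) ^ (2 * m) * (∫ x in D, v x * eps (k + 1) x) ^ 2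

/-- `g ∈ L²(D)` is the generalized derivative `∂^j v` of `v ∈ L²(D)` on `D`. -/
def IsWeakDeriv (j : ℕ) (v g : L2D) : Prop :=
  ∀ φ : ℝ → ℝ, ContDiff ℝ (⊤ : ℕ∞) φ → HasCompactSupport φ → tsupport φ ⊆ D →
    ∫ x in D, v x * iteratedDeriv j φ x = (-1) ^ j * ∫ x in D, g x * φ x

/-- `v ∈ Ḣ⁴(D)` and `f = Λ_B v = ∂⁴v + μ ∂²v`. -/
def IsLambdaB (μ : ℝ) (v f : L2D) : Prop :=
  MemHdot 4 v ∧ ∃ d2 d4 : L2D, IsWeakDeriv 2 v d2 ∧ IsWeakDeriv 4 v d4 ∧ f = d4 + μ • d2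

/-- `(U^m)_{m=0}^M` are the Backward Euler time-discrete approximations: almost surely `U⁰ = 0`
and, for `m = 1, …, M`, `U^m ∈ Ḣ⁴(D)` and
`U^m - U^{m-1} + Δτ Λ_B U^m = ∫_{τ_{m-1}}^{τ_m} ∂ₓŴ ds` in `L²(D)`, where `Δτ = T / M` and
`τ_m = m Δτ`. -/
def IsBackwardEuler {Ω : Type*} [MeasurableSpace Ω] (P : Measure Ω) {T : ℝ}
    (W : Lp ℝ 2 (cylinder T) → Ω → ℝ) (μ : ℝ) (N J M : ℕ) (U : ℕ → Ω → L2D) : Prop :=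
  ∀ᵐ ω ∂P,
    U 0 ω = 0 ∧
    ∀ m < M, ∃ f : L2D, IsLambdaB μ (U (m + 1) ω) f ∧
      ∀ᵐ x ∂(volume.restrict D),
        U (m + 1) ω x - U m ω x + T / M * f x
          = ∫ s in ((m : ℝ) * (T / M))..(((m : ℝ) + 1) * (T / M)), dxRegNoise W N J ω s x

/-- `ω₁(Δτ,ε) = ε^{-1/2} + Δτ^ε (1 + Δτ^{7/4} + Δτ^{3/4})^{1/2}`. -/
def omegaOne (Δτ ε : ℝ) : ℝ :=
  ε ^ (-(1 / 2) : ℝ)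
    + Δτ ^ ε * (1 + Δτ ^ (7 / 4 : ℝ) + Δτ ^ (3 / 4 : ℝ)) ^ (1 / 2 : ℝ)

end

end CahnHilliardCook

open CahnHilliardCook

/-!
Everything is diagonal in the sine basis `ε_k`, which is complete in `L²(D)`
(`eq_zero_of_inner_sineLp`). With `a = λ_k⁴ - μ λ_k²` and `f_k = (∂ₓŴ, ε_k)`, a step function of
time, the `k`-th coefficient of `û` solves `y' + a y = f_k`, and that of the Backward Euler scheme
solves the corresponding implicit recursion (`inner_sineLp_of_isLambdaB` identifies `Λ_B` with
multiplication by `a`). Both are convolutions with `f_k` (`duhamel`, `euler_duhamel`), so the modal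
error at time `τ_m` is `∫₀^{τ_m} K_k(τ_m - s) f_k(s) ds`, where for the time step `d` and
`(l - 1) d < σ ≤ l d`
`K_k(σ) = (1 + d a)⁻ˡ - e^{-aσ}`.

Since `f_k = -λ_k (Ŵ, √2 cos (λ_k ·))` and `Ŵ` is the image of the white noise under the orthogonal
projection onto the space-time finite element space, the second moment of the modal error is at most
`2 λ_k² ∫ K_k²`, uniformly in the discretization of the noise (`integral_sq_sum_forceCoef_le`).

For `a > 0` the integral `∫ K_k²` is at most `2 d`, because `|K_k| ≤ 1` and the integral of `|K_k|`
is compared with telescoping and geometric sums, and at most `2 / a`. The finitely many modes with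
`a ≤ 0` satisfy `|K_k| ≤ C d`. Hence `∫ K_k² ≤ C min(d, λ_k⁻⁴)` in all cases
(`exists_errorKernel_bound`), and
`∑ λ_k² min(d, λ_k⁻⁴) ≤ C ∑ (k + d^{-1/4})⁻² ≤ C d^{1/4}`.
So the root mean square error is `O(d^{1/8})`, with no loss in the exponent; the bound with
`ω₁(d, ε) d^{1/8 - ε}` follows from `ω₁(d, ε) ≥ d^ε`.
-/

namespace CahnHilliardCook

/-! ### The sine basis of `L²(D)` -/

theorem integral_D (f : ℝ → ℝ) : ∫ x in D, f x = ∫ x in (0 : ℝ)..1, f x := by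
  rw [intervalIntegral.integral_of_le zero_le_one, integral_Ioc_eq_integral_Ioo]

theorem contDiff_eps (k : ℕ) : ContDiff ℝ (⊤ : ℕ∞) (eps k) := by
  unfold eps; fun_prop

theorem continuous_eps (k : ℕ) : Continuous (eps k) := (contDiff_eps k).continuous

theorem memLp_of_continuous {f : ℝ → ℝ} (hf : Continuous f) :
    MemLp f 2 (volume.restrict D) := by
  obtain ⟨C, hC⟩ := (isCompact_Icc (a := (0 : ℝ)) (b := 1)).exists_bound_of_continuousOn
    hf.continuousOn
  refine MemLp.of_bound hf.aestronglyMeasurable C ?_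
  filter_upwards [ae_restrict_mem measurableSet_Ioo] with x hx
  exact hC x (Ioo_subset_Icc_self hx)

theorem integral_cos_int_mul_pi (n : ℤ) (hn : n ≠ 0) :
    ∫ x in (0 : ℝ)..1, Real.cos (n * Real.pi * x) = 0 := by
  have hc : (n : ℝ) * Real.pi ≠ 0 := by positivity
  rw [intervalIntegral.integral_comp_mul_left (fun x => Real.cos x) hc]
  simp [Real.sin_int_mul_pi]

theorem integral_eps_mul_eps (j k : ℕ) :
    ∫ x in D, eps (j + 1) x * eps (k + 1) x = if j = k then 1 else 0 := by
  have h : ∀ x, eps (j + 1) x * eps (k + 1) x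
      = Real.cos (((j - k : ℤ) : ℝ) * Real.pi * x)
        - Real.cos (((j + k + 2 : ℤ) : ℝ) * Real.pi * x) := by
    intro x
    have h2 : √2 * √2 = 2 := Real.mul_self_sqrt (by norm_num)
    have e1 : ((j - k : ℤ) : ℝ) * Real.pi * x = lam (j + 1) * x - lam (k + 1) * x := by
      simp only [lam]; push_cast; ring
    have e2 : ((j + k + 2 : ℤ) : ℝ) * Real.pi * x = lam (j + 1) * x + lam (k + 1) * x := by
      simp only [lam]; push_cast; ring
    rw [e1, e2, Real.cos_sub, Real.cos_add, eps, eps]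
    linear_combination (Real.sin (lam (j + 1) * x) * Real.sin (lam (k + 1) * x)) * h2
  simp only [h]
  rw [integral_D, intervalIntegral.integral_sub (Continuous.intervalIntegrable (by fun_prop) _ _)
    (Continuous.intervalIntegrable (by fun_prop) _ _),
    integral_cos_int_mul_pi (j + k + 2) (by positivity), sub_zero]
  split_ifs with hjk
  · simp [hjk]
  · exact integral_cos_int_mul_pi _ (by omega)

noncomputable section

/-- The sine function `ε_{k+1}` as an element of `L²(D)`; the shift makes the family start
at `k = 0`. -/
def sineLp (k : ℕ) : L2D := (memLp_of_continuous (continuous_eps (k + 1))).toLp _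

theorem inner_toLp {f : ℝ → ℝ} (hf : MemLp f 2 (volume.restrict D)) (v : L2D) :
    ⟪hf.toLp f, v⟫ = ∫ x in D, v x * f x := by
  rw [L2.inner_def]
  refine integral_congr_ae ?_
  filter_upwards [hf.coeFn_toLp] with x hx
  simp [hx]

theorem inner_sineLp (k : ℕ) (v : L2D) : ⟪sineLp k, v⟫ = ∫ x in D, v x * eps (k + 1) x :=
  inner_toLp _ v

theorem orthonormal_sineLp : Orthonormal ℝ sineLp := by
  rw [orthonormal_iff_ite]
  intro i j
  rw [inner_sineLp, ← integral_eps_mul_eps i j]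
  simp_rw [mul_comm (eps (i + 1) _)]
  refine integral_congr_ae ?_
  filter_upwards [(memLp_of_continuous (continuous_eps (j + 1))).coeFn_toLp] with x hx
  simp only [sineLp]
  rw [hx]

theorem integrable_L2D_mul (v : L2D) {f : ℝ → ℝ} (hf : Continuous f) :
    Integrable (fun x => v x * f x) (volume.restrict D) :=
  (Lp.memLp v).integrable_mul (memLp_of_continuous hf)

/-- If `v` is orthogonal to all sines then it is orthogonal to all `sin (kπx) cos (πx) ^ n`,
because `2 sin (kπx) cos (πx) = sin ((k+1)πx) + sin ((k-1)πx)`. -/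
theorem integral_mul_sin_mul_cos_pow (v : L2D) (hv : ∀ k, ⟪sineLp k, v⟫ = 0) (n : ℕ) :
    ∀ k : ℕ, ∫ x in D, v x * (Real.sin (k * Real.pi * x) * Real.cos (Real.pi * x) ^ n) = 0 := by
  induction n with
  | zero =>
    intro k
    rcases k with _ | k
    · simp
    · have h := hv k
      rw [inner_sineLp] at h
      simp only [eps, lam] at h
      have h2 : ∀ x, v x * (√2 * Real.sin (((k + 1 : ℕ) : ℝ) * Real.pi * x))
          = √2 * (v x * (Real.sin (((k + 1 : ℕ) : ℝ) * Real.pi * x)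
            * Real.cos (Real.pi * x) ^ 0)) := fun x => by ring
      simp only [h2] at h
      rw [integral_const_mul] at h
      exact (mul_eq_zero.mp h).resolve_left (by positivity)
  | succ n ih =>
    intro k
    rcases k with _ | k
    · simp
    · have h : ∀ x, v x * (Real.sin (((k + 1 : ℕ) : ℝ) * Real.pi * x)
            * Real.cos (Real.pi * x) ^ (n + 1))
          = 1 / 2 * (v x * (Real.sin (((k + 2 : ℕ) : ℝ) * Real.pi * x)
              * Real.cos (Real.pi * x) ^ n))
            + 1 / 2 * (v x * (Real.sin ((k : ℝ) * Real.pi * x)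
              * Real.cos (Real.pi * x) ^ n)) := by
        intro x
        have e1 : ((k + 2 : ℕ) : ℝ) * Real.pi * x
            = ((k + 1 : ℕ) : ℝ) * Real.pi * x + Real.pi * x := by push_cast; ring
        have e2 : (k : ℝ) * Real.pi * x
            = ((k + 1 : ℕ) : ℝ) * Real.pi * x - Real.pi * x := by push_cast; ring
        rw [e1, e2, Real.sin_add, Real.sin_sub]
        ring
      simp only [h]
      rw [integral_add, integral_const_mul, integral_const_mul, ih, ih]
      · simp
      · exact (integrable_L2D_mul v (by fun_prop)).const_mul _
      · exact (integrable_L2D_mul v (by fun_prop)).const_mul _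

/-- The sines are complete: by Weierstrass approximation in the variable `cos (πx)`, a function
orthogonal to all of them annihilates `sin (πx) g(x)` for every continuous `g`. -/
theorem eq_zero_of_inner_sineLp (v : L2D) (hv : ∀ k, ⟪sineLp k, v⟫ = 0) : v = 0 := by
  have hint : Integrable (fun x => v x * Real.sin (Real.pi * x)) (volume.restrict D) :=
    integrable_L2D_mul v (by fun_prop)
  have hpoly : ∀ p : Polynomial ℝ,
      ∫ x in D, v x * Real.sin (Real.pi * x) * p.eval (Real.cos (Real.pi * x)) = 0 := by
    intro p
    have h1 : ∀ x, v x * Real.sin (Real.pi * x) * p.eval (Real.cos (Real.pi * x))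
        = ∑ i ∈ Finset.range (p.natDegree + 1),
          p.coeff i * (v x * (Real.sin (((1 : ℕ) : ℝ) * Real.pi * x)
            * Real.cos (Real.pi * x) ^ i)) := by
      intro x
      rw [Polynomial.eval_eq_sum_range, Finset.mul_sum]
      refine Finset.sum_congr rfl fun i _ => ?_
      simp only [Nat.cast_one, one_mul]
      ring
    simp only [h1]
    rw [integral_finsetSum]
    · refine Finset.sum_eq_zero fun i _ => ?_
      rw [integral_const_mul, integral_mul_sin_mul_cos_pow v hv, mul_zero]
    · intro i _
      exact (integrable_L2D_mul v (by fun_prop)).const_mul _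
  have hcont : ∀ g : ℝ → ℝ, Continuous g →
      ∫ x in D, g x • (v x * Real.sin (Real.pi * x)) = 0 := by
    intro g hg
    set B := ∫ x in D, ‖v x * Real.sin (Real.pi * x)‖ with hB
    have hB0 : 0 ≤ B := integral_nonneg fun x => norm_nonneg _
    have hgi : Integrable (fun x => g x • (v x * Real.sin (Real.pi * x)))
        (volume.restrict D) := by
      refine (integrable_L2D_mul v (f := fun x => Real.sin (Real.pi * x) * g x)
        (by fun_prop)).congr (Filter.Eventually.of_forall fun x => ?_)
      simp only [smul_eq_mul]; ring
    refine abs_eq_zero.mp (le_antisymm (le_of_forall_pos_le_add fun δ hδ => ?_) (abs_nonneg _))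
    obtain ⟨p, hp⟩ := exists_polynomial_near_of_continuousOn (-1) 1
      (fun y => g (Real.arccos y / Real.pi))
      (hg.comp (Real.continuous_arccos.div_const _)).continuousOn (δ / (B + 1)) (by positivity)
    have hpi : Integrable
        (fun x => v x * Real.sin (Real.pi * x) * p.eval (Real.cos (Real.pi * x)))
        (volume.restrict D) := by
      refine (integrable_L2D_mul v
        (f := fun x => Real.sin (Real.pi * x) * p.eval (Real.cos (Real.pi * x)))
        (by fun_prop)).congr (Filter.Eventually.of_forall fun x => ?_)
      simp only; ring
    have hsub := integral_sub hgi hpi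
    rw [hpoly, sub_zero] at hsub
    rw [← hsub, zero_add, ← Real.norm_eq_abs]
    calc ‖∫ x in D, (g x • (v x * Real.sin (Real.pi * x))
          - v x * Real.sin (Real.pi * x) * p.eval (Real.cos (Real.pi * x)))‖
        ≤ ∫ x in D, δ / (B + 1) * ‖v x * Real.sin (Real.pi * x)‖ := by
          refine norm_integral_le_of_norm_le (hint.norm.const_mul _) ?_
          filter_upwards [ae_restrict_mem measurableSet_Ioo] with x hx
          have hx' := hp (Real.cos (Real.pi * x)) ⟨Real.neg_one_le_cos _, Real.cos_le_one _⟩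
          have hpx : Real.arccos (Real.cos (Real.pi * x)) / Real.pi = x := by
            rw [Real.arccos_cos (by nlinarith [Real.pi_pos, hx.1])
              (by nlinarith [Real.pi_pos, hx.2])]
            field_simp
          rw [hpx] at hx'
          have : g x • (v x * Real.sin (Real.pi * x))
              - v x * Real.sin (Real.pi * x) * p.eval (Real.cos (Real.pi * x))
              = -(p.eval (Real.cos (Real.pi * x)) - g x) * (v x * Real.sin (Real.pi * x)) := by
            simp only [smul_eq_mul]; ring
          rw [this, norm_mul, norm_neg, Real.norm_eq_abs (_ - _)]
          exact mul_le_mul_of_nonneg_right hx'.le (norm_nonneg _)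
      _ = δ / (B + 1) * B := by rw [integral_const_mul]
      _ ≤ δ := by
          rw [div_mul_eq_mul_div, div_le_iff₀ (by positivity)]
          nlinarith
  have hae := isOpen_Ioo.ae_eq_zero_of_integral_contDiff_smul_eq_zero (U := D) (μ := volume)
    (f := fun x => v x * Real.sin (Real.pi * x)) (IntegrableOn.locallyIntegrableOn hint) (by
      intro g hg _ hgs
      have h0 := hcont g hg.continuous
      rw [setIntegral_eq_integral_of_forall_compl_eq_zero] at h0
      · exact h0
      · intro x hx
        rw [image_eq_zero_of_notMem_tsupport fun h => hx (hgs h), zero_smul])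
  rw [Lp.eq_zero_iff_ae_eq_zero]
  filter_upwards [(ae_restrict_iff' measurableSet_Ioo).mpr hae, ae_restrict_mem measurableSet_Ioo]
    with x hx hxD
  refine (mul_eq_zero.mp hx).resolve_right (Real.sin_pos_of_pos_of_lt_pi ?_ ?_).ne'
  · exact mul_pos Real.pi_pos hxD.1
  · nlinarith [Real.pi_pos, hxD.2]

/-- The sines `ε₁, ε₂, …` form a Hilbert basis of `L²(D)`. -/
def sineBasis : HilbertBasis ℕ ℝ L2D :=
  HilbertBasis.mkOfOrthogonalEqBot orthonormal_sineLp (by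
    rw [Submodule.eq_bot_iff]
    intro v hv
    exact eq_zero_of_inner_sineLp v fun k =>
      (Submodule.mem_orthogonal _ v).mp hv _ (Submodule.subset_span (mem_range_self k)))

theorem hasSum_inner_sineLp_smul (v : L2D) : HasSum (fun k => ⟪sineLp k, v⟫ • sineLp k) v := by
  have h := sineBasis.hasSum_repr v
  simpa only [HilbertBasis.repr_apply_apply, sineBasis,
    HilbertBasis.coe_mkOfOrthogonalEqBot] using h

theorem hasSum_inner_sineLp_mul (v w : L2D) :
    HasSum (fun k => ⟪sineLp k, v⟫ * ⟪sineLp k, w⟫) ⟪v, w⟫ := by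
  have h := sineBasis.hasSum_inner_mul_inner v w
  simp only [sineBasis, HilbertBasis.coe_mkOfOrthogonalEqBot] at h
  simpa only [real_inner_comm v] using h

theorem hasSum_sq_inner_sineLp (v : L2D) : HasSum (fun k => ⟪sineLp k, v⟫ ^ 2) (‖v‖ ^ 2) := by
  have h := hasSum_inner_sineLp_mul v v
  rw [real_inner_self_eq_norm_sq] at h
  simpa only [sq] using h

/-- Riesz–Fischer for the sine basis. -/
theorem exists_inner_sineLp_eq (c : ℕ → ℝ) (hc : Summable fun k => c k ^ 2) :
    ∃ g : L2D, ∀ k, ⟪sineLp k, g⟫ = c k := by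
  have hm : Memℓp c 2 := by
    rw [memℓp_gen_iff (by norm_num)]
    simpa using hc
  refine ⟨sineBasis.repr.symm ⟨c, hm⟩, fun k => ?_⟩
  have h := sineBasis.repr_apply_apply (sineBasis.repr.symm ⟨c, hm⟩) k
  rw [LinearIsometryEquiv.apply_symm_apply] at h
  simp only [sineBasis, HilbertBasis.coe_mkOfOrthogonalEqBot] at h
  exact h.symm

end

/-! ### Sine coefficients of the elliptic operator -/

/-- The symbol of `Λ_B`: its eigenvalue `λ_k⁴ - μ λ_k²` at `ε_k`. -/
noncomputable def symb (μ : ℝ) (k : ℕ) : ℝ := lam k ^ 4 - μ * lam k ^ 2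

theorem eps_zero (k : ℕ) : eps k 0 = 0 := by simp [eps]

theorem eps_one (k : ℕ) : eps k 1 = 0 := by simp [eps, lam, Real.sin_nat_mul_pi]

/-- `√2 cos (λ_k x)`. -/
noncomputable def ceps (k : ℕ) (x : ℝ) : ℝ := √2 * Real.cos (lam k * x)

theorem continuous_ceps (k : ℕ) : Continuous (ceps k) := by unfold ceps; fun_prop

theorem hasDerivAt_eps (k : ℕ) (x : ℝ) : HasDerivAt (eps k) (lam k * ceps k x) x := by
  have h := (((hasDerivAt_id x).const_mul (lam k)).sin).const_mul √2
  refine h.congr_deriv ?_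
  simp only [ceps, id_eq, mul_one]; ring

theorem hasDerivAt_ceps (k : ℕ) (x : ℝ) : HasDerivAt (ceps k) (-(lam k * eps k x)) x := by
  have h := (((hasDerivAt_id x).const_mul (lam k)).cos).const_mul √2
  refine h.congr_deriv ?_
  simp only [eps, id_eq, mul_one]; ring

theorem iteratedDeriv_two_eps (k : ℕ) :
    iteratedDeriv 2 (eps k) = fun x => -lam k ^ 2 * eps k x := by
  have h1 : deriv (eps k) = fun x => lam k * ceps k x := funext fun x => (hasDerivAt_eps k x).deriv
  rw [iteratedDeriv_succ, iteratedDeriv_one, h1]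
  funext x
  rw [((hasDerivAt_ceps k x).const_mul (lam k)).deriv]
  ring

theorem iteratedDeriv_four {f : ℝ → ℝ} :
    iteratedDeriv 4 f = iteratedDeriv 2 (iteratedDeriv 2 f) := by
  simp only [iteratedDeriv_eq_iterate, Function.iterate_succ, Function.iterate_zero,
    Function.comp_apply, id_eq]

theorem iteratedDeriv_four_eps (k : ℕ) :
    iteratedDeriv 4 (eps k) = fun x => lam k ^ 4 * eps k x := by
  rw [iteratedDeriv_four, iteratedDeriv_two_eps]
  funext x
  rw [iteratedDeriv_const_mul_field, iteratedDeriv_two_eps]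
  ring

theorem isTestFunction_eps (k : ℕ) : IsTestFunction (eps k) where
  smooth := contDiff_eps k
  left := eps_zero k
  right := eps_one k
  left_two := by simp [iteratedDeriv_two_eps, eps_zero]
  right_two := by simp [iteratedDeriv_two_eps, eps_one]

theorem integral_eps_mul_iteratedDeriv_two (k : ℕ) {φ : ℝ → ℝ} (hφ : ContDiff ℝ (⊤ : ℕ∞) φ)
    (h0 : φ 0 = 0) (h1 : φ 1 = 0) :
    ∫ x in D, eps k x * iteratedDeriv 2 φ x = -lam k ^ 2 * ∫ x in D, eps k x * φ x := by
  have hd : ContDiff ℝ (⊤ : ℕ∞) (deriv φ) := by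
    have := hφ.iterate_deriv 1
    simpa using this
  have hd2 : Continuous (deriv (deriv φ)) := hd.continuous_deriv (by simp)
  have hφ1 : ∀ x, HasDerivAt φ (deriv φ x) x := fun x =>
    (hφ.differentiable (by simp) x).hasDerivAt
  have hφ2 : ∀ x, HasDerivAt (deriv φ) (deriv (deriv φ) x) x := fun x =>
    (hd.differentiable (by simp) x).hasDerivAt
  have e2 : iteratedDeriv 2 φ = deriv (deriv φ) := by
    rw [iteratedDeriv_succ, iteratedDeriv_one]
  have A := intervalIntegral.integral_mul_deriv_eq_deriv_mul (a := 0) (b := 1)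
    (u := eps k) (v := deriv φ) (fun x _ => hasDerivAt_eps k x) (fun x _ => hφ2 x)
    (((continuous_ceps k).const_mul _).intervalIntegrable _ _) (hd2.intervalIntegrable _ _)
  have B := intervalIntegral.integral_mul_deriv_eq_deriv_mul (a := 0) (b := 1)
    (u := fun x => lam k * ceps k x) (v := φ)
    (fun x _ => (hasDerivAt_ceps k x).const_mul (lam k)) (fun x _ => hφ1 x)
    ((((continuous_eps k).const_mul _).neg.const_mul _).intervalIntegrable _ _)
    (hd.continuous.intervalIntegrable _ _)
  rw [integral_D, integral_D, e2, A, B, eps_zero, eps_one, h0, h1,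
    ← intervalIntegral.integral_const_mul]
  simp only [zero_mul, mul_zero, zero_sub, sub_self]
  rw [neg_neg]
  congr 1
  funext x
  ring

theorem inner_sineLp_toLp (k : ℕ) {f : ℝ → ℝ} (hf : MemLp f 2 (volume.restrict D)) :
    ⟪sineLp k, hf.toLp f⟫ = ∫ x in D, eps (k + 1) x * f x := by
  rw [inner_sineLp]
  refine integral_congr_ae ?_
  filter_upwards [hf.coeFn_toLp] with x hx
  rw [hx, mul_comm]

theorem ext_of_integral_mul_eq {v w : L2D} (h : ∀ φ : ℝ → ℝ, ContDiff ℝ (⊤ : ℕ∞) φ →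
    HasCompactSupport φ → tsupport φ ⊆ D → ∫ x in D, v x * φ x = ∫ x in D, w x * φ x) :
    v = w := by
  have hi : ∀ z : L2D, Integrable z (volume.restrict D) := fun z => by
    simpa using integrable_L2D_mul z (f := fun _ => 1) continuous_const
  have hae := isOpen_Ioo.ae_eq_zero_of_integral_contDiff_smul_eq_zero (U := D) (μ := volume)
    (f := fun x => v x - w x) (IntegrableOn.locallyIntegrableOn ((hi v).sub (hi w))) (by
      intro g hg hgc hgs
      have h0 := h g hg hgc hgs
      rw [← sub_eq_zero, ← integral_sub (integrable_L2D_mul v hg.continuous)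
        (integrable_L2D_mul w hg.continuous)] at h0
      rw [setIntegral_eq_integral_of_forall_compl_eq_zero] at h0
      · rw [← h0]
        congr 1
        funext x
        simp only [smul_eq_mul]; ring
      · intro x hx
        rw [image_eq_zero_of_notMem_tsupport fun h => hx (hgs h)]
        simp)
  refine Lp.ext ?_
  filter_upwards [(ae_restrict_iff' measurableSet_Ioo).mpr hae] with x hx
  exact sub_eq_zero.mp hx

/-- A generalized derivative of even order `j` acts on sine coefficients as a multiplier as soon
as it does so for test functions and the multiplied coefficients are square summable: it agrees
with the sine series having those coefficients. -/
theorem inner_sineLp_of_isWeakDeriv {j : ℕ} (hj : Even j) {v d : L2D} (hd : IsWeakDeriv j v d)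
    (c : ℕ → ℝ) (hc : Summable fun k => (c k * ⟪sineLp k, v⟫) ^ 2)
    (hφ : ∀ φ : ℝ → ℝ, ContDiff ℝ (⊤ : ℕ∞) φ → tsupport φ ⊆ D → ∀ k,
      ∫ x in D, eps (k + 1) x * iteratedDeriv j φ x = c k * ∫ x in D, eps (k + 1) x * φ x)
    (k : ℕ) : ⟪sineLp k, d⟫ = c k * ⟪sineLp k, v⟫ := by
  obtain ⟨g, hg⟩ := exists_inner_sineLp_eq _ hc
  have hdg : d = g := by
    refine ext_of_integral_mul_eq fun φ h1 h2 h3 => ?_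
    have hj' := hd φ h1 h2 h3
    rw [hj.neg_one_pow, one_mul] at hj'
    have hm1 := memLp_of_continuous h1.continuous
    have hm2 := memLp_of_continuous
      (h1.continuous_iteratedDeriv j (by exact_mod_cast le_top))
    rw [← hj', ← inner_toLp hm2, ← inner_toLp hm1, real_inner_comm, real_inner_comm g]
    have s1 := hasSum_inner_sineLp_mul v (hm2.toLp _)
    have s2 := hasSum_inner_sineLp_mul g (hm1.toLp _)
    refine s1.unique (s2.congr_fun ?_)
    intro k
    rw [inner_sineLp_toLp, inner_sineLp_toLp, hφ φ h1 h3, hg]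
    ring
  rw [hdg, hg]

theorem one_le_lam_succ (k : ℕ) : 1 ≤ lam (k + 1) := by
  have := Real.pi_gt_three
  have hk : (0 : ℝ) ≤ k := k.cast_nonneg
  simp only [lam]; push_cast
  nlinarith

/-- `Λ_B` is diagonal in the sine basis. -/
theorem inner_sineLp_of_isLambdaB {μ : ℝ} {v f : L2D} (h : IsLambdaB μ v f) (k : ℕ) :
    ⟪sineLp k, f⟫ = symb μ (k + 1) * ⟪sineLp k, v⟫ := by
  obtain ⟨hv, d2, d4, h2, h4, rfl⟩ := h
  have hends : ∀ φ : ℝ → ℝ, tsupport φ ⊆ D → φ 0 = 0 ∧ φ 1 = 0 := fun φ hs =>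
    ⟨image_eq_zero_of_notMem_tsupport fun h => by simpa using hs h,
      image_eq_zero_of_notMem_tsupport fun h => by simpa using hs h⟩
  have hc4 : Summable fun k => (lam (k + 1) ^ 4 * ⟪sineLp k, v⟫) ^ 2 := by
    refine hv.congr fun k => ?_
    rw [inner_sineLp]; ring
  have hc2 : Summable fun k => (-lam (k + 1) ^ 2 * ⟪sineLp k, v⟫) ^ 2 := by
    refine hc4.of_nonneg_of_le (fun k => sq_nonneg _) fun k => ?_
    have h1 : lam (k + 1) ^ 4 ≤ lam (k + 1) ^ 8 :=
      pow_le_pow_right₀ (one_le_lam_succ k) (by norm_num)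
    nlinarith [mul_le_mul_of_nonneg_right h1 (sq_nonneg ⟪sineLp k, v⟫)]
  have e2 := inner_sineLp_of_isWeakDeriv (by decide) h2 _ hc2 (fun φ h1 hs k =>
    integral_eps_mul_iteratedDeriv_two (k + 1) h1 (hends φ hs).1 (hends φ hs).2) k
  have e4 := inner_sineLp_of_isWeakDeriv (by decide) h4 _ hc4 (fun φ h1 hs k => by
    have hs2 : tsupport (iteratedDeriv 2 φ) ⊆ D := by
      rw [iteratedDeriv_succ, iteratedDeriv_one]
      exact (tsupport_deriv_subset.trans tsupport_deriv_subset).trans hs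
    have hd2 : ContDiff ℝ (⊤ : ℕ∞) (iteratedDeriv 2 φ) := by
      rw [iteratedDeriv_eq_iterate]
      exact h1.iterate_deriv 2
    rw [iteratedDeriv_four, integral_eps_mul_iteratedDeriv_two (k + 1) hd2 (hends _ hs2).1
      (hends _ hs2).2, integral_eps_mul_iteratedDeriv_two (k + 1) h1 (hends φ hs).1
      (hends φ hs).2]
    ring) k
  rw [inner_add_right, inner_smul_right, e2, e4, symb]
  ring

/-! ### Sine coefficients of the regularized noise -/

theorem lipschitzWith_hat (J : ℕ) (i : Fin (J + 1)) : LipschitzWith J (hat J i) := by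
  refine LipschitzWith.of_dist_le_mul fun x y => ?_
  simp only [hat, Real.dist_eq, NNReal.coe_natCast]
  have h1 : |max 0 (1 - |(J : ℝ) * x - i|) - max 0 (1 - |(J : ℝ) * y - i|)|
      ≤ |(1 - |(J : ℝ) * x - i|) - (1 - |(J : ℝ) * y - i|)| := by
    have := abs_max_sub_max_le_max 0 (1 - |(J : ℝ) * x - i|) 0 (1 - |(J : ℝ) * y - i|)
    simpa using this
  refine h1.trans ?_
  have h2 := abs_abs_sub_abs_le ((J : ℝ) * y - i) ((J : ℝ) * x - i)
  have e1 : (1 - |(J : ℝ) * x - i|) - (1 - |(J : ℝ) * y - i|)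
      = |(J : ℝ) * y - i| - |(J : ℝ) * x - i| := by ring
  have e2 : ((J : ℝ) * y - i) - ((J : ℝ) * x - i) = J * (y - x) := by ring
  rw [e1]
  rw [e2, abs_mul, abs_of_nonneg (Nat.cast_nonneg J : (0 : ℝ) ≤ J), abs_sub_comm y x] at h2
  exact h2

theorem continuous_hat (J : ℕ) (i : Fin (J + 1)) : Continuous (hat J i) :=
  (lipschitzWith_hat J i).continuous

/-- The nodes of the uniform partition with mesh `1/J`, extended periodically to `ℝ`. -/
def nodes (J : ℕ) : Set ℝ := {x | ∃ z : ℤ, (J : ℝ) * x = z}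

theorem countable_nodes {J : ℕ} (hJ : 1 ≤ J) : (nodes J).Countable := by
  have hJ0 : (J : ℝ) ≠ 0 := by positivity
  refine (countable_range fun z : ℤ => (z : ℝ) / J).mono ?_
  rintro x ⟨z, hz⟩
  exact ⟨z, by simp only [← hz]; field_simp⟩

theorem differentiableAt_hat {J : ℕ} (i : Fin (J + 1)) {x : ℝ} (hx : x ∉ nodes J) :
    DifferentiableAt ℝ (hat J i) x := by
  have hne : ∀ z : ℤ, (J : ℝ) * x - i ≠ z := fun z hz => hx ⟨z + i, by push_cast; linarith⟩
  have h0 : (J : ℝ) * x - i ≠ 0 := by simpa using hne 0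
  have habs : DifferentiableAt ℝ (fun y : ℝ => 1 - |(J : ℝ) * y - i|) x :=
    (DifferentiableAt.abs (f := fun y : ℝ => (J : ℝ) * y - i) (by fun_prop) h0).const_sub 1
  have hc : Continuous fun y : ℝ => 1 - |(J : ℝ) * y - i| := by fun_prop
  have h1 : |(J : ℝ) * x - i| ≠ 1 := by
    intro h
    rcases (abs_eq zero_le_one).mp h with h | h
    · exact hne 1 (by simpa using h)
    · exact hne (-1) (by simpa using h)
  rcases lt_or_gt_of_ne h1 with h | h
  · refine habs.congr_of_eventuallyEq ?_
    filter_upwards [(hc.tendsto x).eventually (lt_mem_nhds (sub_pos.mpr h))] with y hy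
    exact max_eq_right hy.le
  · refine (differentiableAt_const (0 : ℝ)).congr_of_eventuallyEq ?_
    filter_upwards [(hc.tendsto x).eventually (gt_mem_nhds (sub_neg.mpr h))] with y hy
    exact max_eq_left hy.le

theorem integrable_deriv_hat_mul (J : ℕ) (i : Fin (J + 1)) {g : ℝ → ℝ} (hg : Continuous g) :
    Integrable (fun x => deriv (hat J i) x * g x) (volume.restrict D) := by
  have hm : MemLp (deriv (hat J i)) 2 (volume.restrict D) :=
    MemLp.of_bound (measurable_deriv _).aestronglyMeasurable J
      (Filter.Eventually.of_forall fun x => by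
        simpa using norm_deriv_le_of_lipschitz (lipschitzWith_hat J i))
  exact hm.integrable_mul (memLp_of_continuous hg)

/-- Integration by parts; the boundary terms vanish because `ε_k` does. -/
theorem integral_deriv_hat_mul_eps {J : ℕ} (hJ : 1 ≤ J) (i : Fin (J + 1)) (k : ℕ) :
    ∫ x in D, deriv (hat J i) x * eps k x = -lam k * ∫ x in D, hat J i x * ceps k x := by
  have hi1 := integrable_deriv_hat_mul J i (continuous_eps k)
  have hc2 : Continuous fun x => hat J i x * (lam k * ceps k x) :=
    (continuous_hat J i).mul ((continuous_ceps k).const_mul _)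
  have hi2 : Integrable (fun x => hat J i x * (lam k * ceps k x)) (volume.restrict D) :=
    (memLp_of_continuous hc2).integrable (by norm_num)
  have hftc := integral_eq_of_hasDerivAt_off_countable (a := 0) (b := 1)
    (fun x => hat J i x * eps k x)
    (fun x => deriv (hat J i) x * eps k x + hat J i x * (lam k * ceps k x))
    (countable_nodes hJ)
    ((continuous_hat J i).mul (continuous_eps k)).continuousOn
    (fun x hx => (differentiableAt_hat i hx.2).hasDerivAt.mul (hasDerivAt_eps k x))
    (by
      rw [intervalIntegrable_iff_integrableOn_Ioo_of_le zero_le_one]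
      exact hi1.add hi2)
  rw [← integral_D, integral_add hi1 hi2, eps_zero, eps_one] at hftc
  have e : ∫ x in D, hat J i x * (lam k * ceps k x) = lam k * ∫ x in D, hat J i x * ceps k x := by
    rw [← integral_const_mul]
    congr 1
    funext x
    ring
  rw [e] at hftc
  linarith

noncomputable section

/-- The coefficient of `𝟙_{T_n}(t) ψ_l(x)` in the regularized noise. -/
def noiseCoef {Ω : Type*} {T : ℝ} (W : Lp ℝ 2 (cylinder T) → Ω → ℝ) (N J : ℕ)
    (n : Fin N) (l : Fin (J + 1)) (ω : Ω) : ℝ :=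
  1 / (T / N) * ∑ m : Fin (J + 1), (gram J)⁻¹ l m * cellNoise W N J n m ω

/-- The value of `(∂ₓŴ(t), ε_k)` for `t` in the time cell `n`. -/
def forceCoef {Ω : Type*} {T : ℝ} (W : Lp ℝ 2 (cylinder T) → Ω → ℝ) (N J k : ℕ) (ω : Ω)
    (n : Fin N) : ℝ :=
  ∑ l : Fin (J + 1), noiseCoef W N J n l ω * ∫ x in D, deriv (hat J l) x * eps k x

/-- The step function with value `F n` on the time cell `n`. -/
def stepFun (T : ℝ) (N : ℕ) (F : Fin N → ℝ) (s : ℝ) : ℝ :=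
  ∑ n : Fin N, (timeCell T N n).indicator 1 s * F n

variable {Ω : Type*} {T : ℝ} (W : Lp ℝ 2 (cylinder T) → Ω → ℝ)

/-- At the nodes, a null set, `deriv` may return the junk value `0`; off them it acts termwise, for
all times at once. -/
theorem dxRegNoise_eq {N J : ℕ} (ω : Ω) (s : ℝ) {x : ℝ} (hx : x ∉ nodes J) :
    dxRegNoise W N J ω s x = ∑ n : Fin N, (timeCell T N n).indicator 1 s *
      ∑ l : Fin (J + 1), noiseCoef W N J n l ω * deriv (hat J l) x := by
  have e : (fun y => regNoise W N J ω s y) = fun y => ∑ n : Fin N,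
      (timeCell T N n).indicator 1 s * ∑ l : Fin (J + 1), noiseCoef W N J n l ω * hat J l y := by
    funext y
    simp only [regNoise, noiseCoef]
    rw [Finset.mul_sum]
    refine Finset.sum_congr rfl fun n _ => ?_
    rw [mul_left_comm, Finset.mul_sum]
    congr 1
    exact Finset.sum_congr rfl fun l _ => by ring
  rw [dxRegNoise, e]
  have hd : HasDerivAt (fun y => ∑ n : Fin N,
      (timeCell T N n).indicator 1 s * ∑ l : Fin (J + 1), noiseCoef W N J n l ω * hat J l y)
      (∑ n : Fin N, (timeCell T N n).indicator 1 s *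
        ∑ l : Fin (J + 1), noiseCoef W N J n l ω * deriv (hat J l) x) x :=
    HasDerivAt.fun_sum fun n _ => (HasDerivAt.fun_sum fun l _ =>
      (differentiableAt_hat l hx).hasDerivAt.const_mul _).const_mul _
  exact hd.deriv

theorem ae_notMem_nodes {J : ℕ} (hJ : 1 ≤ J) : ∀ᵐ x ∂(volume.restrict D), x ∉ nodes J :=
  ae_restrict_of_ae ((countable_nodes hJ).ae_notMem volume)

theorem integral_sum_deriv_hat_mul_eps (N J k : ℕ) (ω : Ω) (c : Fin N → ℝ) :
    ∫ x in D, (∑ n : Fin N, c n *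
        ∑ l : Fin (J + 1), noiseCoef W N J n l ω * deriv (hat J l) x) * eps k x
      = ∑ n : Fin N, c n * forceCoef W N J k ω n := by
  have e : ∀ x, (∑ n : Fin N, c n *
        ∑ l : Fin (J + 1), noiseCoef W N J n l ω * deriv (hat J l) x) * eps k x
      = ∑ n : Fin N, ∑ l : Fin (J + 1),
        c n * noiseCoef W N J n l ω * (deriv (hat J l) x * eps k x) := by
    intro x
    simp only [Finset.mul_sum, Finset.sum_mul]
    exact Finset.sum_congr rfl fun n _ => Finset.sum_congr rfl fun l _ => by ring
  have hint : ∀ n : Fin N, ∀ l : Fin (J + 1), Integrable (fun x =>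
      c n * noiseCoef W N J n l ω * (deriv (hat J l) x * eps k x)) (volume.restrict D) :=
    fun n l => (integrable_deriv_hat_mul J l (continuous_eps k)).const_mul _
  simp only [e]
  rw [integral_finsetSum _ fun n _ => integrable_finsetSum _ fun l _ => hint n l]
  refine Finset.sum_congr rfl fun n _ => ?_
  rw [integral_finsetSum _ fun l _ => hint n l, forceCoef, Finset.mul_sum]
  refine Finset.sum_congr rfl fun l _ => ?_
  rw [integral_const_mul, mul_assoc]

theorem integral_dxRegNoise_mul_eps {N J : ℕ} (hJ : 1 ≤ J) (k : ℕ) (ω : Ω) (s : ℝ) :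
    ∫ x in D, dxRegNoise W N J ω s x * eps k x = stepFun T N (forceCoef W N J k ω) s := by
  rw [stepFun, ← integral_sum_deriv_hat_mul_eps]
  refine integral_congr_ae ?_
  filter_upwards [ae_notMem_nodes hJ] with x hx
  rw [dxRegNoise_eq W ω s hx]

theorem measurableSet_timeCell (T : ℝ) {N : ℕ} (n : Fin N) : MeasurableSet (timeCell T N n) :=
  measurableSet_Ioo

theorem intervalIntegrable_indicator_timeCell (T : ℝ) {N : ℕ} (n : Fin N) (a b : ℝ) :
    IntervalIntegrable ((timeCell T N n).indicator (1 : ℝ → ℝ)) volume a b :=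
  ⟨(integrableOn_const (by simp)).indicator measurableSet_Ioo,
    (integrableOn_const (by simp)).indicator measurableSet_Ioo⟩

theorem intervalIntegrable_stepFun (T : ℝ) {N : ℕ} (F : Fin N → ℝ) (a b : ℝ) :
    IntervalIntegrable (stepFun T N F) volume a b := by
  have := IntervalIntegrable.sum Finset.univ (f := fun (n : Fin N) s =>
    (timeCell T N n).indicator 1 s * F n) (μ := volume) (a := a) (b := b)
    fun n _ => (intervalIntegrable_indicator_timeCell T n a b).mul_const (F n)
  refine this.congr fun s _ => ?_
  simp [stepFun]

theorem integral_integral_dxRegNoise_mul_eps {N J : ℕ} (hJ : 1 ≤ J) (k : ℕ) (ω : Ω) (a b : ℝ) :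
    ∫ x in D, (∫ s in a..b, dxRegNoise W N J ω s x) * eps k x
      = ∫ s in a..b, stepFun T N (forceCoef W N J k ω) s := by
  have h1 : ∫ s in a..b, stepFun T N (forceCoef W N J k ω) s
      = ∑ n : Fin N, (∫ s in a..b, (timeCell T N n).indicator (1 : ℝ → ℝ) s)
        * forceCoef W N J k ω n := by
    simp only [stepFun]
    rw [intervalIntegral.integral_finsetSum fun n _ =>
      (intervalIntegrable_indicator_timeCell T n a b).mul_const _]
    exact Finset.sum_congr rfl fun n _ => intervalIntegral.integral_mul_const _ _
  rw [h1, ← integral_sum_deriv_hat_mul_eps]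
  refine integral_congr_ae ?_
  filter_upwards [ae_notMem_nodes hJ] with x hx
  simp only [dxRegNoise_eq W ω _ hx]
  rw [intervalIntegral.integral_finsetSum fun n _ =>
    (intervalIntegrable_indicator_timeCell T n a b).mul_const _]
  congr 1
  exact Finset.sum_congr rfl fun n _ => intervalIntegral.integral_mul_const _ _

end

/-! ### Duhamel formulas for the exact and the Backward Euler coefficients -/

/-- The endpoints of the time cells. -/
def cellEnds (T : ℝ) (N : ℕ) : Set ℝ :=
  ⋃ n : Fin N, {(n : ℝ) * (T / N), ((n : ℝ) + 1) * (T / N)}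

theorem countable_cellEnds (T : ℝ) (N : ℕ) : (cellEnds T N).Countable :=
  countable_iUnion fun _ => (countable_singleton _).insert _

theorem continuousAt_stepFun {T : ℝ} {N : ℕ} (F : Fin N → ℝ) {s : ℝ} (hs : s ∉ cellEnds T N) :
    ContinuousAt (stepFun T N F) s := by
  have h : ∀ n : Fin N, ContinuousAt (fun s => (timeCell T N n).indicator (1 : ℝ → ℝ) s) s := by
    intro n
    have hne : s ≠ (n : ℝ) * (T / N) ∧ s ≠ ((n : ℝ) + 1) * (T / N) := by
      constructor <;> intro h <;> exact hs (mem_iUnion.mpr ⟨n, by simp [← h]⟩)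
    by_cases hm : s ∈ timeCell T N n
    · refine (continuousAt_const (y := (1 : ℝ))).congr ?_
      filter_upwards [isOpen_Ioo.mem_nhds hm] with t ht
      exact (indicator_of_mem (s := timeCell T N n) ht (1 : ℝ → ℝ)).symm
    · refine (continuousAt_const (y := (0 : ℝ))).congr ?_
      rw [timeCell, mem_Ioo, not_and_or, not_lt, not_lt] at hm
      rcases hm with hm | hm
      · filter_upwards [Iio_mem_nhds (lt_of_le_of_ne hm hne.1)] with t ht
        exact (indicator_of_notMem (fun h => lt_asymm ht h.1) _).symm
      · filter_upwards [Ioi_mem_nhds (lt_of_le_of_ne hm hne.2.symm)] with t ht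
        exact (indicator_of_notMem (fun h => lt_asymm ht h.2) _).symm
  exact tendsto_finsetSum _ fun n _ => (h n).mul_const (F n)

/-- Variation of constants for `y' + a y = f` in integrated form, `f` a step function. -/
theorem duhamel {T a : ℝ} {N : ℕ} (F : Fin N → ℝ) {y : ℝ → ℝ}
    (hy : ContinuousOn y (Icc 0 T))
    (heq : ∀ t ∈ Icc (0 : ℝ) T, y t + a * ∫ s in (0 : ℝ)..t, y s
      = ∫ s in (0 : ℝ)..t, stepFun T N F s)
    {τ : ℝ} (hτ : τ ∈ Icc 0 T) :
    y τ = ∫ s in (0 : ℝ)..τ, Real.exp (-(a * (τ - s))) * stepFun T N F s := by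
  have hT : 0 ≤ T := hτ.1.trans hτ.2
  have hy0 : y 0 = 0 := by simpa using heq 0 ⟨le_rfl, hT⟩
  have hint : IntervalIntegrable (fun s => Real.exp (a * s) * stepFun T N F s) volume 0 τ :=
    (intervalIntegrable_stepFun T F 0 τ).continuousOn_mul (by fun_prop)
  have hftc := integral_eq_of_hasDerivAt_off_countable (a := 0) (b := τ)
    (fun s => Real.exp (a * s) * y s) (fun s => Real.exp (a * s) * stepFun T N F s)
    (countable_cellEnds T N)
    (by
      rw [uIcc_of_le hτ.1]
      exact ContinuousOn.mul (by fun_prop) (hy.mono (Icc_subset_Icc_right hτ.2)))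
    (fun s hs => by
      obtain ⟨hs, hse⟩ := hs
      rw [min_eq_left hτ.1, max_eq_right hτ.1] at hs
      have hsT : s ∈ Ioo 0 T := ⟨hs.1, hs.2.trans_le hτ.2⟩
      have hyc : ContinuousAt y s := hy.continuousAt (Icc_mem_nhds hsT.1 hsT.2)
      have hyi : IntervalIntegrable y volume 0 s :=
        (hy.mono (by rw [uIcc_of_le hs.1.le]; exact Icc_subset_Icc_right hsT.2.le)).intervalIntegrable
      have hym : StronglyMeasurableAtFilter y (nhds s) volume :=
        ⟨Ioo 0 T, Ioo_mem_nhds hsT.1 hsT.2,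
          (hy.mono Ioo_subset_Icc_self).aestronglyMeasurable measurableSet_Ioo⟩
      have hfm : StronglyMeasurableAtFilter (stepFun T N F) (nhds s) volume :=
        ⟨Ioc 0 T, Filter.mem_of_superset (Ioo_mem_nhds hsT.1 hsT.2) Ioo_subset_Ioc_self,
          (intervalIntegrable_stepFun T F 0 T).1.aestronglyMeasurable⟩
      have d1 := intervalIntegral.integral_hasDerivAt_right hyi hym hyc
      have d2 := intervalIntegral.integral_hasDerivAt_right
        (intervalIntegrable_stepFun T F 0 s) hfm (continuousAt_stepFun F hse)
      have d3 : HasDerivAt y (stepFun T N F s - a * y s) s := by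
        refine (d2.sub (d1.const_mul a)).congr_of_eventuallyEq ?_
        filter_upwards [Icc_mem_nhds hsT.1 hsT.2] with t ht
        simp only [Pi.sub_apply]
        linarith [heq t ht]
      have d4 : HasDerivAt (fun s => Real.exp (a * s)) (Real.exp (a * s) * (a * 1)) s :=
        ((hasDerivAt_id s).const_mul a).exp
      refine (d4.mul d3).congr_deriv ?_
      ring)
    hint
  rw [hy0, mul_zero, sub_zero] at hftc
  have e : ∀ s, Real.exp (-(a * (τ - s))) * stepFun T N F s
      = Real.exp (-(a * τ)) * (Real.exp (a * s) * stepFun T N F s) := by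
    intro s
    rw [← mul_assoc, ← Real.exp_add]
    congr 2
    ring
  simp only [e]
  rw [intervalIntegral.integral_const_mul, hftc, ← mul_assoc, ← Real.exp_add]
  simp

noncomputable section

/-- The kernel of the Backward Euler scheme with amplification factor `r` and time step `d`: in
the `l`-th step before the final time, `(l - 1) d < σ ≤ l d`, its value is `r ^ l`. -/
def eulerKernel (r d σ : ℝ) : ℝ := r ^ ⌈σ / d⌉₊

theorem measurable_eulerKernel (r d : ℝ) : Measurable (eulerKernel r d) := by
  have h1 : Measurable fun σ : ℝ => ⌈σ / d⌉₊ := Nat.measurable_ceil.comp (measurable_id.div_const d)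
  exact (measurable_from_nat (f := fun n : ℕ => r ^ n)).comp h1

theorem eulerKernel_eq {r d σ : ℝ} (hd : 0 < d) (l : ℕ) (h1 : l * d < σ) (h2 : σ ≤ (l + 1) * d) :
    eulerKernel r d σ = r ^ (l + 1) := by
  rw [eulerKernel, (Nat.ceil_eq_iff (Nat.succ_ne_zero l)).mpr]
  constructor
  · rw [lt_div_iff₀ hd]; simpa using h1
  · rw [div_le_iff₀ hd]; push_cast; exact h2

theorem abs_eulerKernel_le {r d σ : ℝ} (hd : 0 < d) {m : ℕ} (h : σ ≤ m * d) :
    |eulerKernel r d σ| ≤ (1 + |r|) ^ m := by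
  rw [eulerKernel, abs_pow]
  have h1 : ⌈σ / d⌉₊ ≤ m := Nat.ceil_le.mpr ((div_le_iff₀ hd).mpr h)
  exact (pow_le_pow_left₀ (abs_nonneg r) (by linarith [abs_nonneg r]) _).trans
    (pow_le_pow_right₀ (by linarith [abs_nonneg r]) h1)

/-- The difference of the Backward Euler kernel and the exact one. -/
def errorKernel (a d σ : ℝ) : ℝ := eulerKernel (1 / (1 + d * a)) d σ - Real.exp (-(a * σ))

theorem intervalIntegrable_eulerKernel_mul {r d : ℝ} (hd : 0 < d) (m : ℕ) {f : ℝ → ℝ} {b : ℝ}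
    (hb : 0 ≤ b) (hf : IntervalIntegrable f volume 0 b) :
    IntervalIntegrable (fun s => eulerKernel r d (m * d - s) * f s) volume 0 b := by
  rw [intervalIntegrable_iff_integrableOn_Ioc_of_le hb] at hf ⊢
  refine Integrable.bdd_mul (c := (1 + |r|) ^ m) hf
    ((measurable_eulerKernel r d).comp (by fun_prop)).aestronglyMeasurable ?_
  filter_upwards [ae_restrict_mem measurableSet_Ioc] with s hs
  exact abs_eulerKernel_le hd (by linarith [hs.1])

/-- Solution formula for the Backward Euler recursion. -/
theorem euler_duhamel {T a d : ℝ} (hd : 0 < d) (ha : 1 + d * a ≠ 0) {N M : ℕ} (F : Fin N → ℝ)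
    {V : ℕ → ℝ} (hV0 : V 0 = 0)
    (hV : ∀ m < M, V (m + 1) - V m + d * (a * V (m + 1))
      = ∫ s in ((m : ℝ) * d)..(((m : ℝ) + 1) * d), stepFun T N F s)
    {m : ℕ} (hm : m ≤ M) :
    V m = ∫ s in (0 : ℝ)..(m * d),
      eulerKernel (1 / (1 + d * a)) d (m * d - s) * stepFun T N F s := by
  set r := 1 / (1 + d * a) with hr
  induction m with
  | zero => simp [hV0]
  | succ m ih =>
    have ih' := ih (by omega)
    have h1 := hV m (by omega)
    have hmd : (0 : ℝ) ≤ m * d := by positivity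
    have hmd' : (m : ℝ) * d ≤ (m + 1) * d := by nlinarith
    have hV1 : V (m + 1) = r * V m
        + r * ∫ s in ((m : ℝ) * d)..(((m : ℝ) + 1) * d), stepFun T N F s := by
      rw [← mul_add, ← h1, hr]; field_simp; ring
    have hint := intervalIntegrable_eulerKernel_mul (r := r) hd (m + 1) (f := stepFun T N F)
      (hmd.trans hmd') (intervalIntegrable_stepFun T F _ _)
    push_cast at hint ⊢
    have hmem : (m : ℝ) * d ∈ uIcc 0 (((m : ℝ) + 1) * d) := by
      rw [uIcc_of_le (hmd.trans hmd')]; exact ⟨hmd, hmd'⟩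
    rw [hV1, ih', ← intervalIntegral.integral_add_adjacent_intervals
      (hint.mono_set (uIcc_subset_uIcc_left hmem)) (hint.mono_set (uIcc_subset_uIcc_right hmem))]
    congr 1
    · rw [← intervalIntegral.integral_const_mul]
      refine intervalIntegral.integral_congr fun s hs => ?_
      rw [uIcc_of_le hmd] at hs
      have e : ((m : ℝ) + 1) * d - s = (m * d - s) + d := by ring
      simp only [eulerKernel]
      rw [e, add_div, div_self hd.ne', Nat.ceil_add_one (div_nonneg (by linarith [hs.2]) hd.le),
        pow_succ]
      ring
    · rw [← intervalIntegral.integral_const_mul, intervalIntegral.integral_of_le hmd',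
        intervalIntegral.integral_of_le hmd', integral_Ioc_eq_integral_Ioo,
        integral_Ioc_eq_integral_Ioo]
      refine setIntegral_congr_fun measurableSet_Ioo fun s hs => ?_
      rw [eulerKernel_eq hd 0 (by simp only [Nat.cast_zero]; linarith [hs.2])
        (by simp only [Nat.cast_zero]; linarith [hs.1])]
      ring

theorem duhamel_error {T a d : ℝ} (hd : 0 < d) (ha : 1 + d * a ≠ 0) {N M : ℕ} (F : Fin N → ℝ)
    {y : ℝ → ℝ} (hy : ContinuousOn y (Icc 0 T))
    (heq : ∀ t ∈ Icc (0 : ℝ) T, y t + a * ∫ s in (0 : ℝ)..t, y s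
      = ∫ s in (0 : ℝ)..t, stepFun T N F s)
    {V : ℕ → ℝ} (hV0 : V 0 = 0)
    (hV : ∀ m < M, V (m + 1) - V m + d * (a * V (m + 1))
      = ∫ s in ((m : ℝ) * d)..(((m : ℝ) + 1) * d), stepFun T N F s)
    {m : ℕ} (hm : m ≤ M) (hmT : m * d ≤ T) :
    V m - y (m * d) = ∑ n : Fin N, F n *
      ∫ s in (0 : ℝ)..(m * d), (timeCell T N n).indicator 1 s * errorKernel a d (m * d - s) := by
  have hmd : (0 : ℝ) ≤ m * d := by positivity
  have hint : ∀ f : ℝ → ℝ, IntervalIntegrable f volume 0 (m * d) →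
      IntervalIntegrable (fun s => Real.exp (-(a * (m * d - s))) * f s) volume 0 (m * d) :=
    fun f hf => hf.continuousOn_mul (by fun_prop)
  rw [euler_duhamel hd ha F hV0 hV hm, duhamel F hy heq ⟨hmd, hmT⟩,
    ← intervalIntegral.integral_sub
      (intervalIntegrable_eulerKernel_mul hd m hmd (intervalIntegrable_stepFun T F _ _))
      (hint _ (intervalIntegrable_stepFun T F _ _))]
  have e : ∀ s, eulerKernel (1 / (1 + d * a)) d (m * d - s) * stepFun T N F s
      - Real.exp (-(a * (m * d - s))) * stepFun T N F s
      = ∑ n : Fin N, F n * ((timeCell T N n).indicator 1 s * errorKernel a d (m * d - s)) := by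
    intro s
    rw [← sub_mul, stepFun, Finset.mul_sum]
    exact Finset.sum_congr rfl fun n _ => by rw [errorKernel]; ring
  simp only [e]
  rw [intervalIntegral.integral_finsetSum]
  · exact Finset.sum_congr rfl fun n _ => intervalIntegral.integral_const_mul _ _
  · intro n _
    refine IntervalIntegrable.const_mul ?_ (F n)
    have hi := intervalIntegrable_indicator_timeCell T n 0 (m * d)
    refine ((intervalIntegrable_eulerKernel_mul (r := 1 / (1 + d * a)) hd m hmd hi).sub
      (hint _ hi)).congr fun s _ => ?_
    simp only [errorKernel]
    ring

end

/-! ### Square integrals of the error kernel -/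

theorem measurable_errorKernel (a d : ℝ) : Measurable (errorKernel a d) :=
  (measurable_eulerKernel _ d).sub (by fun_prop)

theorem abs_errorKernel_le {a d σ : ℝ} (hd : 0 < d) {m : ℕ} (h0 : 0 ≤ σ) (h : σ ≤ m * d) :
    |errorKernel a d σ| ≤ (1 + |1 / (1 + d * a)|) ^ m + Real.exp (|a| * (m * d)) := by
  refine (abs_sub _ _).trans (add_le_add (abs_eulerKernel_le hd h) ?_)
  rw [Real.abs_exp]
  refine Real.exp_le_exp.mpr ?_
  calc -(a * σ) ≤ |a| * σ := by nlinarith [neg_abs_le a]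
    _ ≤ |a| * (m * d) := mul_le_mul_of_nonneg_left h (abs_nonneg a)

theorem intervalIntegrable_eulerKernel (r : ℝ) {d : ℝ} (hd : 0 < d) (m : ℕ) :
    IntervalIntegrable (eulerKernel r d) volume 0 (m * d) := by
  have hmd : (0 : ℝ) ≤ m * d := by positivity
  rw [intervalIntegrable_iff_integrableOn_Ioc_of_le hmd]
  refine Measure.integrableOn_of_bounded (M := (1 + |r|) ^ m) measure_Ioc_lt_top.ne
    (measurable_eulerKernel r d).aestronglyMeasurable ?_
  filter_upwards [ae_restrict_mem measurableSet_Ioc] with s hs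
  exact abs_eulerKernel_le hd hs.2

theorem intervalIntegrable_errorKernel (a : ℝ) {d : ℝ} (hd : 0 < d) (m : ℕ) :
    IntervalIntegrable (errorKernel a d) volume 0 (m * d) :=
  (intervalIntegrable_eulerKernel _ hd m).sub (Continuous.intervalIntegrable (by fun_prop) _ _)

theorem intervalIntegrable_errorKernel_sq (a : ℝ) {d : ℝ} (hd : 0 < d) (m : ℕ) :
    IntervalIntegrable (fun σ => errorKernel a d σ ^ 2) volume 0 (m * d) := by
  have hmd : (0 : ℝ) ≤ m * d := by positivity
  rw [intervalIntegrable_iff_integrableOn_Ioc_of_le hmd]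
  refine Measure.integrableOn_of_bounded
    (M := ((1 + |1 / (1 + d * a)|) ^ m + Real.exp (|a| * (m * d))) ^ 2) measure_Ioc_lt_top.ne
    ((measurable_errorKernel a d).pow_const 2).aestronglyMeasurable ?_
  filter_upwards [ae_restrict_mem measurableSet_Ioc] with s hs
  rw [norm_pow, Real.norm_eq_abs]
  exact pow_le_pow_left₀ (abs_nonneg _) (abs_errorKernel_le hd hs.1.le hs.2) 2

theorem integral_le_of_le_on_steps {d : ℝ} (hd : 0 < d) {g : ℝ → ℝ} (c : ℕ → ℝ) (m : ℕ)
    (hg : IntervalIntegrable g volume 0 (m * d))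
    (h : ∀ l < m, ∀ σ, l * d < σ → σ < (l + 1) * d → g σ ≤ c l) :
    ∫ σ in (0 : ℝ)..(m * d), g σ ≤ d * ∑ l ∈ Finset.range m, c l := by
  induction m with
  | zero => simp
  | succ m ih =>
    have hmd : (0 : ℝ) ≤ m * d := by positivity
    have hmd' : (m : ℝ) * d ≤ (m + 1) * d := by nlinarith
    push_cast at hg ⊢
    have hmem : (m : ℝ) * d ∈ uIcc 0 (((m : ℝ) + 1) * d) := by
      rw [uIcc_of_le (hmd.trans hmd')]; exact ⟨hmd, hmd'⟩
    have g1 := hg.mono_set (uIcc_subset_uIcc_left hmem)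
    have g2 := hg.mono_set (uIcc_subset_uIcc_right hmem)
    rw [← intervalIntegral.integral_add_adjacent_intervals g1 g2, Finset.sum_range_succ, mul_add]
    refine add_le_add (ih g1 fun l hl => h l (by omega)) ?_
    have := intervalIntegral.integral_mono_on_of_le_Ioo hmd' g2
      (intervalIntegrable_const (c := c m)) fun σ hσ => h m (by omega) σ hσ.1 hσ.2
    refine this.trans (le_of_eq ?_)
    rw [intervalIntegral.integral_const, smul_eq_mul]
    ring

theorem errorKernel_eq {a d σ : ℝ} (hd : 0 < d) (l : ℕ) (h1 : l * d < σ) (h2 : σ ≤ (l + 1) * d) :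
    errorKernel a d σ = (1 / (1 + d * a)) ^ (l + 1) - Real.exp (-(a * σ)) := by
  rw [errorKernel, eulerKernel_eq hd l h1 h2]

theorem sum_range_pow_succ_resolvent {z : ℝ} (hz : 0 < z) (m : ℕ) :
    ∑ l ∈ Finset.range m, (1 / (1 + z)) ^ (l + 1) = (1 - (1 / (1 + z)) ^ m) / z := by
  have h1 : 1 / (1 + z) ≠ 1 := by
    rw [Ne, div_eq_one_iff_eq (by positivity)]; linarith
  simp only [pow_succ']
  rw [← Finset.mul_sum, geom_sum_eq h1]
  have e : 1 / (1 + z) - 1 = -(z * (1 / (1 + z))) := by field_simp; ring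
  rw [e]
  field_simp
  ring

/-- The resolvent powers exceed the semigroup by at most `1` in total:
`∑ r ^ (l+1) = (1 - r ^ m) / z` and `∑ q ^ (l+1) = (1 - q ^ m) q / (1 - q)` for `q = e^{-z} ≤ r`,
where `1 / z - q / (1 - q) ≤ 1` amounts to `1 - z ≤ q`. -/
theorem sum_range_resolvent_sub_exp_le {z : ℝ} (hz : 0 < z) (m : ℕ) :
    ∑ l ∈ Finset.range m, ((1 / (1 + z)) ^ (l + 1) - Real.exp (-z) ^ (l + 1)) ≤ 1 := by
  have hq1 : Real.exp (-z) < 1 := by simpa using hz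
  have hq0 : 0 < Real.exp (-z) := Real.exp_pos _
  have hqz : 1 - z ≤ Real.exp (-z) := by linarith [Real.add_one_le_exp (-z)]
  have hqr : Real.exp (-z) ≤ 1 / (1 + z) := by
    rw [Real.exp_neg, ← one_div]
    exact one_div_le_one_div_of_le (by positivity) (by linarith [Real.add_one_le_exp z])
  have hr1 : 1 / (1 + z) ≤ 1 := by rw [div_le_one (by positivity)]; linarith
  rw [Finset.sum_sub_distrib, sum_range_pow_succ_resolvent hz]
  set q := Real.exp (-z)
  set r := 1 / (1 + z)
  have hr0 : 0 ≤ r := hq0.le.trans hqr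
  have hsum : ∑ l ∈ Finset.range m, q ^ (l + 1) = (1 - q ^ m) * (q / (1 - q)) := by
    simp only [pow_succ']
    rw [← Finset.mul_sum, geom_sum_eq hq1.ne]
    have : q - 1 ≠ 0 := by linarith
    have : 1 - q ≠ 0 := by linarith
    field_simp
    ring
  have hrm0 : 0 ≤ r ^ m := pow_nonneg hr0 m
  have hrm1 : r ^ m ≤ 1 := pow_le_one₀ hr0 hr1
  have hqm : q ^ m ≤ r ^ m := pow_le_pow_left₀ hq0.le hqr m
  have hX : 0 ≤ q / (1 - q) := div_nonneg hq0.le (by linarith)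
  have hXz : 1 / z - q / (1 - q) ≤ 1 := by
    rw [div_sub_div _ _ hz.ne' (by linarith), div_le_one (mul_pos hz (by linarith))]
    nlinarith
  rw [hsum]
  calc (1 - r ^ m) / z - (1 - q ^ m) * (q / (1 - q))
      ≤ (1 - r ^ m) / z - (1 - r ^ m) * (q / (1 - q)) := by
        have := mul_le_mul_of_nonneg_right (sub_le_sub_left hqm 1) hX
        linarith
    _ = (1 - r ^ m) * (1 / z - q / (1 - q)) := by ring
    _ ≤ (1 - r ^ m) * 1 := mul_le_mul_of_nonneg_left hXz (by linarith)
    _ ≤ 1 := by linarith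

/-- On stable modes the kernel error is of order `d`: it is bounded by `1`, and its `L¹` norm is
at most `2 d`. -/
theorem integral_errorKernel_sq_le_step {a d : ℝ} (ha : 0 < a) (hd : 0 < d) (m : ℕ) :
    ∫ σ in (0 : ℝ)..(m * d), errorKernel a d σ ^ 2 ≤ 2 * d := by
  have hz : 0 < d * a := by positivity
  set z := d * a with hzdef
  have hqr : Real.exp (-z) ≤ 1 / (1 + z) := by
    rw [Real.exp_neg, ← one_div]
    exact one_div_le_one_div_of_le (by positivity) (by linarith [Real.add_one_le_exp z])
  have hr1 : 1 / (1 + z) ≤ 1 := by rw [div_le_one (by positivity)]; linarith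
  have hr0 : 0 ≤ 1 / (1 + z) := by positivity
  have hb := integral_le_of_le_on_steps hd
    (fun l => ((1 / (1 + z)) ^ (l + 1) - Real.exp (-z) ^ (l + 1))
      + (Real.exp (-z) ^ l - Real.exp (-z) ^ (l + 1))) m
    (intervalIntegrable_errorKernel_sq a hd m) (by
      intro l _ σ h1 h2
      rw [errorKernel_eq hd l h1 h2.le, ← hzdef]
      have e1 : Real.exp (-(a * σ)) ≤ Real.exp (-z) ^ l := by
        rw [← Real.exp_nat_mul]
        exact Real.exp_le_exp.mpr (by rw [hzdef]; nlinarith)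
      have e2 : Real.exp (-z) ^ (l + 1) ≤ Real.exp (-(a * σ)) := by
        rw [← Real.exp_nat_mul]
        exact Real.exp_le_exp.mpr (by rw [hzdef]; push_cast; nlinarith)
      have e3 : Real.exp (-z) ^ (l + 1) ≤ (1 / (1 + z)) ^ (l + 1) :=
        pow_le_pow_left₀ (Real.exp_pos _).le hqr _
      have e4 : (1 / (1 + z)) ^ (l + 1) ≤ 1 := pow_le_one₀ hr0 hr1
      have e5 : 0 ≤ (1 / (1 + z)) ^ (l + 1) := pow_nonneg hr0 _
      have e6 : Real.exp (-(a * σ)) ≤ 1 := by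
        have : 0 ≤ l * d := by positivity
        rw [Real.exp_le_one_iff]; nlinarith
      have e7 := Real.exp_pos (-(a * σ))
      generalize Real.exp (-(a * σ)) = y at *
      generalize (1 / (1 + z)) ^ (l + 1) = x at *
      have k1 : (x - y) ^ 2 ≤ |x - y| := by
        rw [← sq_abs]
        have : |x - y| ≤ 1 := abs_le.mpr ⟨by linarith, by linarith⟩
        nlinarith [abs_nonneg (x - y)]
      refine k1.trans (abs_le.mpr ⟨by linarith, by linarith⟩))
  refine hb.trans ?_
  rw [Finset.sum_add_distrib, Finset.sum_range_sub' (fun l => Real.exp (-z) ^ l)]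
  have s1 := sum_range_resolvent_sub_exp_le hz m
  have s2 : 0 ≤ Real.exp (-z) ^ m := by positivity
  rw [pow_zero]
  nlinarith

/-- On stable modes each of the two kernels has `L¹` norm at most `1 / a`. -/
theorem integral_errorKernel_sq_le_inv {a d : ℝ} (ha : 0 < a) (hd : 0 < d) (m : ℕ) :
    ∫ σ in (0 : ℝ)..(m * d), errorKernel a d σ ^ 2 ≤ 2 / a := by
  have hz : 0 < d * a := by positivity
  have hmd : (0 : ℝ) ≤ m * d := by positivity
  set z := d * a with hzdef
  have hr1 : 1 / (1 + z) ≤ 1 := by rw [div_le_one (by positivity)]; linarith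
  have hr0 : 0 ≤ 1 / (1 + z) := by positivity
  have hexp : IntervalIntegrable (fun σ => Real.exp (-(a * σ))) volume 0 (m * d) :=
    Continuous.intervalIntegrable (by fun_prop) _ _
  have hE := intervalIntegrable_eulerKernel (1 / (1 + z)) hd m
  have h1 : ∫ σ in (0 : ℝ)..(m * d), errorKernel a d σ ^ 2
      ≤ ∫ σ in (0 : ℝ)..(m * d), (eulerKernel (1 / (1 + z)) d σ + Real.exp (-(a * σ))) := by
    refine intervalIntegral.integral_mono_on hmd (intervalIntegrable_errorKernel_sq a hd m)
      (hE.add hexp) fun σ hσ => ?_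
    rw [errorKernel, ← hzdef]
    have e4 : eulerKernel (1 / (1 + z)) d σ ≤ 1 := pow_le_one₀ hr0 hr1
    have e5 : 0 ≤ eulerKernel (1 / (1 + z)) d σ := pow_nonneg hr0 _
    have e6 : Real.exp (-(a * σ)) ≤ 1 := by
      rw [Real.exp_le_one_iff]; nlinarith [hσ.1]
    have e7 := Real.exp_pos (-(a * σ))
    nlinarith
  have h2 : ∫ σ in (0 : ℝ)..(m * d), eulerKernel (1 / (1 + z)) d σ ≤ 1 / a := by
    refine (integral_le_of_le_on_steps hd (fun l => (1 / (1 + z)) ^ (l + 1)) m hE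
      fun l _ σ h1 h2 => (eulerKernel_eq hd l h1 h2.le).le).trans ?_
    rw [sum_range_pow_succ_resolvent hz]
    have : 0 ≤ (1 / (1 + z)) ^ m := pow_nonneg hr0 m
    have e : d * ((1 - (1 / (1 + z)) ^ m) / z) = (1 - (1 / (1 + z)) ^ m) / a := by
      rw [hzdef]; field_simp
    rw [e]
    exact div_le_div_of_nonneg_right (by linarith) ha.le
  have h3 : ∫ σ in (0 : ℝ)..(m * d), Real.exp (-(a * σ)) ≤ 1 / a := by
    have hder : ∀ σ ∈ uIcc 0 ((m : ℝ) * d),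
        HasDerivAt (fun σ => -(Real.exp (-(a * σ)) / a)) (Real.exp (-(a * σ))) σ := by
      intro σ _
      refine (((((hasDerivAt_id σ).const_mul a).neg).exp.div_const a).neg).congr_deriv ?_
      simp only [Pi.neg_apply, id_eq]
      field_simp
    rw [intervalIntegral.integral_eq_sub_of_hasDerivAt hder hexp]
    have : 0 ≤ Real.exp (-(a * (m * d))) / a := by positivity
    simp only [mul_zero, neg_zero, Real.exp_zero]
    linarith
  rw [intervalIntegral.integral_add hE hexp] at h1
  have : 2 / a = 1 / a + 1 / a := by ring
  linarith

/-- On the finitely many unstable modes the kernel error is of order `d` uniformly up to time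
`T`. -/
theorem integral_errorKernel_sq_le_unstable {a d B T : ℝ} (ha : a ≤ 0) (haB : -a ≤ B)
    (hd : 0 < d) (hda : d * -a ≤ 1 / 16) (m : ℕ) (hm : m * d ≤ T) :
    ∫ σ in (0 : ℝ)..(m * d), errorKernel a d σ ^ 2
      ≤ T * (Real.exp (2 * B * T) * (B + 2 * B ^ 2 * T) * d) ^ 2 := by
  obtain ⟨b, rfl⟩ : ∃ b, a = -b := ⟨-a, by ring⟩
  rw [neg_neg] at haB hda
  have hb : 0 ≤ b := by linarith
  have hB : 0 ≤ B := hb.trans haB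
  have hmd : (0 : ℝ) ≤ m * d := by positivity
  have hT : 0 ≤ T := hmd.trans hm
  have hz0 : 0 ≤ d * b := by positivity
  set z := d * b with hzdef
  have hr : 1 / (1 + d * -b) = 1 / (1 - z) := by rw [hzdef]; ring_nf
  have hrl : Real.exp z ≤ 1 / (1 - z) := by
    rw [le_div_iff₀ (by linarith), ← le_div_iff₀' (Real.exp_pos _), one_div, ← Real.exp_neg]
    linarith [Real.add_one_le_exp (-z)]
  have hru : 1 / (1 - z) ≤ Real.exp (z + 2 * z ^ 2) := by
    rw [div_le_iff₀ (by linarith)]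
    have h1 := Real.add_one_le_exp (z + 2 * z ^ 2)
    have h2 : 1 ≤ (z + 2 * z ^ 2 + 1) * (1 - z) := by nlinarith [sq_nonneg z]
    exact h2.trans (mul_le_mul_of_nonneg_right h1 (by linarith))
  have hC : 0 ≤ Real.exp (2 * B * T) * (B + 2 * B ^ 2 * T) * d := by positivity
  have hb := integral_le_of_le_on_steps hd
    (fun _ => (Real.exp (2 * B * T) * (B + 2 * B ^ 2 * T) * d) ^ 2) m
    (intervalIntegrable_errorKernel_sq (-b) hd m) (by
      intro l hl σ h1 h2
      rw [errorKernel_eq hd l h1 h2.le, hr]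
      have hlm : ((l : ℝ) + 1) * d ≤ T := by
        have : ((l : ℝ) + 1) ≤ m := by exact_mod_cast hl
        nlinarith
      have hlz : ((l : ℝ) + 1) * z ≤ B * T := by
        calc ((l : ℝ) + 1) * z = b * ((l + 1) * d) := by rw [hzdef]; ring
          _ ≤ B * T := mul_le_mul haB hlm (by positivity) hB
      have hzB : z ≤ B * d := by rw [hzdef]; nlinarith
      have e1 : Real.exp (-(-b * σ)) ≤ (1 / (1 - z)) ^ (l + 1) := by
        refine le_trans ?_ (pow_le_pow_left₀ (Real.exp_pos _).le hrl _)
        rw [← Real.exp_nat_mul]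
        exact Real.exp_le_exp.mpr (by rw [hzdef]; push_cast; nlinarith)
      have e2 : (1 / (1 - z)) ^ (l + 1) ≤ Real.exp (((l : ℝ) + 1) * (z + 2 * z ^ 2)) := by
        refine (pow_le_pow_left₀ ((Real.exp_pos _).le.trans hrl) hru _).trans ?_
        rw [← Real.exp_nat_mul]
        push_cast
        exact le_rfl
      have e3 : Real.exp (l * z) ≤ Real.exp (-(-b * σ)) :=
        Real.exp_le_exp.mpr (by rw [hzdef]; nlinarith)
      have e4 : Real.exp (((l : ℝ) + 1) * (z + 2 * z ^ 2)) - Real.exp (l * z)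
          ≤ Real.exp (2 * B * T) * (B + 2 * B ^ 2 * T) * d := by
        -- `e^X - e^Y ≤ e^X (X - Y)`
        have k1 := Real.add_one_le_exp (l * z - ((l : ℝ) + 1) * (z + 2 * z ^ 2))
        have k2 : Real.exp (l * z) = Real.exp (((l : ℝ) + 1) * (z + 2 * z ^ 2))
            * Real.exp (l * z - ((l : ℝ) + 1) * (z + 2 * z ^ 2)) := by
          rw [← Real.exp_add]; ring_nf
        have k3 : ((l : ℝ) + 1) * (z + 2 * z ^ 2) ≤ 2 * B * T := by
          have : ((l : ℝ) + 1) * (z + 2 * z ^ 2) = (((l : ℝ) + 1) * z) * (1 + 2 * z) := by ring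
          rw [this]
          have : 0 ≤ ((l : ℝ) + 1) * z := by positivity
          nlinarith
        have k4 : ((l : ℝ) + 1) * (z + 2 * z ^ 2) - l * z ≤ (B + 2 * B ^ 2 * T) * d := by
          have : ((l : ℝ) + 1) * (z + 2 * z ^ 2) - l * z = z + 2 * ((((l : ℝ) + 1) * z) * z) := by
            ring
          rw [this]
          have : ((l : ℝ) + 1) * z * z ≤ (B * T) * (B * d) :=
            mul_le_mul hlz hzB hz0 (by positivity)
          nlinarith
        have k5 : 0 ≤ ((l : ℝ) + 1) * (z + 2 * z ^ 2) - l * z := by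
          have : 0 ≤ ((l : ℝ) + 1) * z ^ 2 := by positivity
          nlinarith
        calc Real.exp (((l : ℝ) + 1) * (z + 2 * z ^ 2)) - Real.exp (l * z)
            ≤ Real.exp (((l : ℝ) + 1) * (z + 2 * z ^ 2))
              * (((l : ℝ) + 1) * (z + 2 * z ^ 2) - l * z) := by
              rw [k2]
              nlinarith [Real.exp_pos (((l : ℝ) + 1) * (z + 2 * z ^ 2))]
          _ ≤ Real.exp (2 * B * T) * ((B + 2 * B ^ 2 * T) * d) :=
              mul_le_mul (Real.exp_le_exp.mpr k3) k4 k5 (Real.exp_pos _).le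
          _ = _ := by ring
      exact pow_le_pow_left₀ (by linarith) (by linarith) 2)
  refine hb.trans ?_
  rw [Finset.sum_const, Finset.card_range, nsmul_eq_mul, ← mul_assoc, mul_comm d]
  exact mul_le_mul_of_nonneg_right hm (sq_nonneg _)

theorem mul_lam_pow_le_symb {μ : ℝ} {κ k : ℕ} (hκ : 1 ≤ κ) (hμ0 : 0 ≤ μ) (hk : κ ≤ k) :
    (1 - μ / ((κ : ℝ) ^ 2 * Real.pi ^ 2)) * lam k ^ 4 ≤ symb μ k := by
  have hκ0 : (0 : ℝ) < κ := by exact_mod_cast hκ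
  have hk' : (κ : ℝ) ≤ k := by exact_mod_cast hk
  have h1 : (κ : ℝ) ^ 2 * Real.pi ^ 2 ≤ lam k ^ 2 := by
    rw [lam, mul_pow]
    exact mul_le_mul_of_nonneg_right (pow_le_pow_left₀ hκ0.le hk' 2) (by positivity)
  have h2 : μ ≤ μ / ((κ : ℝ) ^ 2 * Real.pi ^ 2) * lam k ^ 2 := by
    rw [div_mul_eq_mul_div, le_div_iff₀ (by positivity)]
    exact mul_le_mul_of_nonneg_left h1 hμ0
  have h3 := mul_le_mul_of_nonneg_right h2 (sq_nonneg (lam k))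
  rw [symb]
  linear_combination h3

theorem neg_symb_le (μ : ℝ) (k : ℕ) : -symb μ k ≤ μ ^ 2 / 4 := by
  rw [symb]
  nlinarith [sq_nonneg (lam k ^ 2 - μ / 2)]

/-- Uniform bounds for all modes. Modes `k ≥ κ` are stable, with symbol comparable to `λ_k⁴`;
modes `k < κ` occur only for `κ ≥ 2`, and there the step size restriction applies. -/
theorem exists_errorKernel_bound {T : ℝ} (hT : 0 < T) {μ : ℝ} {κ : ℕ} (hκ : 1 ≤ κ)
    (hμ_lower : ((κ : ℝ) - 1) ^ 2 * Real.pi ^ 2 ≤ μ)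
    (hμ_upper : μ < (κ : ℝ) ^ 2 * Real.pi ^ 2) :
    ∃ C : ℝ, 0 < C ∧ ∀ M : ℕ, 1 ≤ M → (κ = 1 ∨ (2 ≤ κ ∧ T / M * μ ^ 2 < 1 / 4)) →
      ∀ k m : ℕ, 1 ≤ k → m ≤ M → 1 + T / M * symb μ k ≠ 0 ∧
        ∫ σ in (0 : ℝ)..(m * (T / M)), errorKernel (symb μ k) (T / M) σ ^ 2 ≤ C * (T / M) ∧
        lam k ^ 4 * ∫ σ in (0 : ℝ)..(m * (T / M)), errorKernel (symb μ k) (T / M) σ ^ 2 ≤ C := by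
  have hπ := Real.pi_pos
  have hκ0 : (0 : ℝ) < κ := by exact_mod_cast hκ
  have hμ0 : 0 ≤ μ := le_trans (by positivity) hμ_lower
  set c := 1 - μ / ((κ : ℝ) ^ 2 * Real.pi ^ 2) with hc
  have hc0 : 0 < c := by
    rw [hc, sub_pos, div_lt_one (by positivity)]; exact hμ_upper
  set B := μ ^ 2 / 4 with hB
  set E := Real.exp (2 * B * T) * (B + 2 * B ^ 2 * T) with hE
  have hE0 : 0 ≤ T * E ^ 2 := by positivity
  set P := T ^ 2 * E ^ 2 with hP
  have hP0 : 0 ≤ P := by positivity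
  have hQ0 : 0 ≤ P * T * (κ * Real.pi) ^ 4 := by positivity
  clear_value c E P
  refine ⟨2 + 2 / c + P + P * T * (κ * Real.pi) ^ 4, by positivity, ?_⟩
  intro M hM hcond k m hk hm
  have hM0 : (0 : ℝ) < M := by exact_mod_cast hM
  set d := T / M with hd
  have hd0 : 0 < d := by positivity
  have hdT : d ≤ T := by
    rw [hd]; exact div_le_self hT.le (by exact_mod_cast hM)
  have hmT : m * d ≤ T := by
    have : (m : ℝ) ≤ M := by exact_mod_cast hm
    calc m * d ≤ M * d := mul_le_mul_of_nonneg_right this hd0.le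
      _ = T := by rw [hd]; field_simp
  have hk0 : (0 : ℝ) < k := by exact_mod_cast hk
  have hlam0 : 0 < lam k := by unfold lam; positivity
  have h2c : 0 < 2 / c := by positivity
  by_cases hkκ : κ ≤ k
  · have hkκ' : (κ : ℝ) ≤ k := by exact_mod_cast hkκ
    have ha : c * lam k ^ 4 ≤ symb μ k := by
      rw [hc]
      exact mul_lam_pow_le_symb hκ hμ0 hkκ
    have ha0 : 0 < symb μ k := lt_of_lt_of_le (by positivity) ha
    have b1 := integral_errorKernel_sq_le_step ha0 hd0 m
    have b2 := integral_errorKernel_sq_le_inv ha0 hd0 m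
    refine ⟨by positivity, b1.trans (mul_le_mul_of_nonneg_right (by linarith) hd0.le), ?_⟩
    have b3 : lam k ^ 4 * (2 / symb μ k) ≤ 2 / c := by
      rw [mul_div_assoc', div_le_div_iff₀ ha0 hc0]
      linear_combination 2 * ha
    exact ((mul_le_mul_of_nonneg_left b2 (by positivity)).trans b3).trans (by linarith)
  · rcases hcond with h1 | ⟨h2, hdμ⟩
    · omega
    · have hkκ' : (k : ℝ) ≤ κ - 1 := by
        have : k + 1 ≤ κ := by omega
        have : (k : ℝ) + 1 ≤ κ := by exact_mod_cast this
        linarith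
      have hlamμ : lam k ^ 2 ≤ μ := by
        refine le_trans ?_ hμ_lower
        rw [lam, mul_pow]
        exact mul_le_mul_of_nonneg_right (pow_le_pow_left₀ hk0.le hkκ' 2) (by positivity)
      have ha : symb μ k ≤ 0 := by
        have := mul_le_mul_of_nonneg_right hlamμ (sq_nonneg (lam k))
        rw [symb]
        linear_combination this
      have haB : -symb μ k ≤ B := neg_symb_le μ k
      have hda : d * -symb μ k ≤ 1 / 16 := by
        have := mul_le_mul_of_nonneg_left haB hd0.le
        rw [hB] at this
        linarith
      have b1 := integral_errorKernel_sq_le_unstable ha haB hd0 hda m hmT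
      rw [← hE] at b1
      have b2 : T * (E * d) ^ 2 ≤ P * d := by
        rw [hP]
        linear_combination mul_le_mul_of_nonneg_left (mul_le_mul_of_nonneg_right hdT hd0.le) hE0
      have hlam4 : lam k ^ 4 ≤ (κ * Real.pi) ^ 4 := by
        refine pow_le_pow_left₀ hlam0.le ?_ 4
        rw [lam]
        exact mul_le_mul_of_nonneg_right (by linarith) hπ.le
      refine ⟨by intro h; linarith, b1.trans (b2.trans
        (mul_le_mul_of_nonneg_right (by linarith) hd0.le)), ?_⟩
      calc lam k ^ 4 * ∫ σ in (0 : ℝ)..(m * d), errorKernel (symb μ k) d σ ^ 2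
          ≤ (κ * Real.pi) ^ 4 * (P * d) :=
            mul_le_mul hlam4 (b1.trans b2) (intervalIntegral.integral_nonneg (by positivity)
              fun _ _ => sq_nonneg _) (by positivity)
        _ ≤ (κ * Real.pi) ^ 4 * (P * T) :=
            mul_le_mul_of_nonneg_left (mul_le_mul_of_nonneg_left hdT hP0) (by positivity)
        _ ≤ _ := by linarith

/-! ### Second moments of the modal errors -/

section

variable {Ω : Type*} [MeasurableSpace Ω] {P : Measure Ω} {T : ℝ}
  {W : Lp ℝ 2 (cylinder T) → Ω → ℝ}

theorem IsWhiteNoise.memLp (hW : IsWhiteNoise P T W) (g : Lp ℝ 2 (cylinder T)) :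
    MemLp (W g) 2 P := (hW.gaussian.hasGaussianLaw_eval g).memLp_two

theorem IsWhiteNoise.integral_sum_sq (hW : IsWhiteNoise P T W) {ι : Type*} [Fintype ι]
    (b : ι → ℝ) (g : ι → Lp ℝ 2 (cylinder T)) :
    ∫ ω, (∑ i, b i * W (g i) ω) ^ 2 ∂P = ∑ i, ∑ j, b i * b j * ⟪g i, g j⟫ := by
  have e : ∀ ω, (∑ i, b i * W (g i) ω) ^ 2
      = ∑ i, ∑ j, b i * b j * (W (g i) ω * W (g j) ω) := by
    intro ω
    rw [sq, Finset.sum_mul_sum]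
    exact Finset.sum_congr rfl fun i _ => Finset.sum_congr rfl fun j _ => by ring
  have hint : ∀ i j, Integrable (fun ω => b i * b j * (W (g i) ω * W (g j) ω)) P :=
    fun i j => ((hW.memLp (g i)).integrable_mul (hW.memLp (g j))).const_mul _
  simp only [e]
  rw [integral_finsetSum _ fun i _ => integrable_finsetSum _ fun j _ => hint i j]
  refine Finset.sum_congr rfl fun i _ => ?_
  rw [integral_finsetSum _ fun j _ => hint i j]
  refine Finset.sum_congr rfl fun j _ => ?_
  rw [integral_const_mul, hW.covariance]

end

theorem disjoint_timeCell {T : ℝ} (hT : 0 < T) {N : ℕ} {n n' : Fin N} (h : n ≠ n') :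
    Disjoint (timeCell T N n) (timeCell T N n') := by
  have hN : 0 < N := n.pos
  have hd : 0 < T / N := by positivity
  rw [Set.disjoint_left]
  intro t h1 h2
  rcases lt_or_gt_of_ne (Fin.val_injective.ne h) with hlt | hlt
  · have : ((n : ℕ) : ℝ) + 1 ≤ (n' : ℕ) := by exact_mod_cast hlt
    nlinarith [h1.2, h2.1]
  · have : ((n' : ℕ) : ℝ) + 1 ≤ (n : ℕ) := by exact_mod_cast hlt
    nlinarith [h2.2, h1.1]

theorem timeCell_subset {T : ℝ} (hT : 0 < T) {N : ℕ} (n : Fin N) :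
    timeCell T N n ⊆ Ioo 0 T := by
  have hN : (0 : ℝ) < N := by exact_mod_cast n.pos
  have hd : 0 < T / N := by positivity
  have h1 : ((n : ℕ) : ℝ) + 1 ≤ N := by exact_mod_cast n.isLt
  have h2 : (N : ℝ) * (T / N) = T := by field_simp
  rintro t ⟨h3, h4⟩
  exact ⟨lt_of_le_of_lt (by positivity) h3, by nlinarith⟩

theorem inner_cellHat {T : ℝ} (hT : 0 < T) (N J : ℕ) (n n' : Fin N) (i j : Fin (J + 1)) :
    ⟪(memLp_cellHat T N J n i).toLp _, (memLp_cellHat T N J n' j).toLp _⟫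
      = if n = n' then T / N * gram J i j else 0 := by
  rw [L2.inner_def]
  have e : ∫ p, ⟪(memLp_cellHat T N J n i).toLp _ p, (memLp_cellHat T N J n' j).toLp _ p⟫
        ∂(cylinder T)
      = ∫ p in Ioo 0 T ×ˢ D, ((timeCell T N n).indicator (1 : ℝ → ℝ) p.1
          * (timeCell T N n').indicator (1 : ℝ → ℝ) p.1) * (hat J j p.2 * hat J i p.2) := by
    refine integral_congr_ae ?_
    filter_upwards [(memLp_cellHat T N J n i).coeFn_toLp, (memLp_cellHat T N J n' j).coeFn_toLp]
      with p h1 h2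
    rw [h1, h2]
    simp only [cellHat, RCLike.inner_apply, conj_trivial]
    ring
  rw [e, Measure.volume_eq_prod,
    setIntegral_prod_mul (fun t => (timeCell T N n).indicator (1 : ℝ → ℝ) t
      * (timeCell T N n').indicator (1 : ℝ → ℝ) t) (fun x => hat J j x * hat J i x)]
  split_ifs with h
  · subst h
    have e2 : ∀ t, (timeCell T N n).indicator (1 : ℝ → ℝ) t
        * (timeCell T N n).indicator (1 : ℝ → ℝ) t = (timeCell T N n).indicator (1 : ℝ → ℝ) t := by
      intro t
      by_cases ht : t ∈ timeCell T N n <;> simp [ht]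
    simp only [e2]
    rw [setIntegral_indicator (measurableSet_timeCell T n), inter_eq_right.mpr (timeCell_subset hT n)]
    have hd : (0 : ℝ) ≤ T / N := by positivity
    simp only [Pi.one_apply, integral_const, smul_eq_mul, mul_one, gram, Matrix.of_apply]
    congr 1
    rw [measureReal_restrict_apply_univ, timeCell, Real.volume_real_Ioo_of_le (by nlinarith)]
    ring
  · have e2 : ∀ t, (timeCell T N n).indicator (1 : ℝ → ℝ) t
        * (timeCell T N n').indicator (1 : ℝ → ℝ) t = 0 := by
      intro t
      by_cases ht : t ∈ timeCell T N n
      · rw [indicator_of_notMem (s := timeCell T N n')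
          (Set.disjoint_left.mp (disjoint_timeCell hT h) ht), mul_zero]
      · rw [indicator_of_notMem ht, zero_mul]
    simp [e2]

noncomputable section

/-- The coefficients, in the hat functions, of the `L²(D)`-orthogonal projection of `√2 cos (λ_k x)`
onto the piecewise affine functions. -/
def projCoef (J k : ℕ) (m : Fin (J + 1)) : ℝ :=
  ∑ l : Fin (J + 1), (∫ x in D, hat J l x * ceps k x) * (gram J)⁻¹ l m

theorem integral_sum_hat_mul {J : ℕ} (q : Fin (J + 1) → ℝ) {g : ℝ → ℝ} (hg : Continuous g) :
    ∫ x in D, (∑ j, q j * hat J j x) * g x = ∑ j, q j * ∫ x in D, hat J j x * g x := by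
  have hint : ∀ j, Integrable (fun x => q j * (hat J j x * g x)) (volume.restrict D) := fun j =>
    ((memLp_of_continuous (continuous_hat J j)).integrable_mul
      (memLp_of_continuous hg)).const_mul _
  simp only [Finset.sum_mul, mul_assoc]
  rw [integral_finsetSum _ fun j _ => hint j]
  exact Finset.sum_congr rfl fun j _ => integral_const_mul _ _

/-- An orthogonal projection does not increase the norm, and `∫ 2 cos² ≤ 2`. -/
theorem sum_projCoef_mul_gram_le (J k : ℕ) :
    ∑ i, ∑ j, projCoef J k i * projCoef J k j * gram J i j ≤ 2 := by
  by_cases hdet : IsUnit (gram J).det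
  · set q := projCoef J k with hq
    have hp : Continuous fun x => ∑ j, q j * hat J j x :=
      continuous_finsetSum _ fun j _ => (continuous_hat J j).const_mul _
    have hqG : ∀ j, ∑ i, q i * gram J i j = ∫ x in D, hat J j x * ceps k x := by
      intro j
      have h1 : q = Matrix.vecMul (fun l => ∫ x in D, hat J l x * ceps k x) (gram J)⁻¹ := by
        funext m
        simp [hq, projCoef, Matrix.vecMul, dotProduct]
      have h2 : Matrix.vecMul q (gram J) j = ∫ x in D, hat J j x * ceps k x := by
        rw [h1, Matrix.vecMul_vecMul, Matrix.nonsing_inv_mul _ hdet, Matrix.vecMul_one]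
      simpa [Matrix.vecMul, dotProduct] using h2
    have hQ1 : ∑ i, ∑ j, q i * q j * gram J i j
        = ∫ x in D, (∑ j, q j * hat J j x) * ceps k x := by
      rw [integral_sum_hat_mul q (continuous_ceps k), Finset.sum_comm]
      refine Finset.sum_congr rfl fun j _ => ?_
      rw [← hqG, Finset.mul_sum]
      exact Finset.sum_congr rfl fun i _ => by ring
    have hQ2 : ∑ i, ∑ j, q i * q j * gram J i j
        = ∫ x in D, (∑ j, q j * hat J j x) * (∑ j, q j * hat J j x) := by
      rw [integral_sum_hat_mul q hp]
      refine Finset.sum_congr rfl fun i _ => ?_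
      have : ∫ x in D, hat J i x * (∑ j, q j * hat J j x) = ∑ j, q j * gram J i j := by
        simp only [mul_comm (hat J i _)]
        rw [integral_sum_hat_mul q (continuous_hat J i)]
        rfl
      rw [this, Finset.mul_sum]
      exact Finset.sum_congr rfl fun j _ => by ring
    have i1 : ∀ {f g : ℝ → ℝ}, Continuous f → Continuous g →
        Integrable (fun x => f x * g x) (volume.restrict D) := fun hf hg =>
      (memLp_of_continuous hf).integrable_mul (memLp_of_continuous hg)
    have h0 : 0 ≤ ∫ x in D, ((∑ j, q j * hat J j x) - ceps k x) ^ 2 :=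
      integral_nonneg fun x => sq_nonneg _
    have e : ∀ x, ((∑ j, q j * hat J j x) - ceps k x) ^ 2
        = ((∑ j, q j * hat J j x) * (∑ j, q j * hat J j x)
          - 2 * ((∑ j, q j * hat J j x) * ceps k x)) + ceps k x * ceps k x := fun x => by ring
    simp only [e] at h0
    have h1 : Integrable (fun x => (∑ j, q j * hat J j x) * (∑ j, q j * hat J j x)
        - 2 * ((∑ j, q j * hat J j x) * ceps k x)) (volume.restrict D) :=
      (i1 hp hp).sub ((i1 hp (continuous_ceps k)).const_mul 2)
    rw [integral_add h1 (i1 (continuous_ceps k) (continuous_ceps k)),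
      integral_sub (i1 hp hp) ((i1 hp (continuous_ceps k)).const_mul 2),
      integral_const_mul, ← hQ1, ← hQ2] at h0
    have hc : ∫ x in D, ceps k x * ceps k x ≤ ∫ x in D, (2 : ℝ) := by
      refine integral_mono (i1 (continuous_ceps k) (continuous_ceps k)) (integrable_const _) ?_
      intro x
      have h2 : √2 * √2 = 2 := Real.mul_self_sqrt (by norm_num)
      have : ceps k x * ceps k x = 2 * Real.cos (lam k * x) ^ 2 := by
        rw [ceps]; linear_combination Real.cos (lam k * x) ^ 2 * h2
      simp only [this]
      linarith [Real.cos_sq_le_one (lam k * x)]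
    have h2 : ∫ x in D, (2 : ℝ) = 2 := by simp
    linarith
  -- the inverse of a singular matrix is `0` by convention, so no regularity of `gram` is needed
  · have : ∀ i, projCoef J k i = 0 := fun i => by
      simp [projCoef, Matrix.nonsing_inv_apply_not_isUnit _ hdet]
    simp [this]

/-- Cauchy–Schwarz on one time cell. -/
theorem sq_integral_timeCell_mul_le {T : ℝ} (hT : 0 < T) {N : ℕ} (n : Fin N) {τ : ℝ} (hτ : 0 ≤ τ)
    {K : ℝ → ℝ} (hK : IntervalIntegrable K volume 0 τ)
    (hK2 : IntervalIntegrable (fun s => K s ^ 2) volume 0 τ) :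
    (∫ s in (0 : ℝ)..τ, (timeCell T N n).indicator 1 s * K s) ^ 2
      ≤ T / N * ∫ s in (0 : ℝ)..τ, (timeCell T N n).indicator 1 s * K s ^ 2 := by
  have hN : (0 : ℝ) < N := by exact_mod_cast n.pos
  have hd : 0 < T / N := by positivity
  set χ : ℝ → ℝ := (timeCell T N n).indicator 1 with hχ
  have hχi : IntervalIntegrable χ volume 0 τ := intervalIntegrable_indicator_timeCell T n 0 τ
  have hχm : Measurable χ := measurable_one.indicator measurableSet_Ioo
  have hχ01 : ∀ s, 0 ≤ χ s ∧ χ s ≤ 1 := fun s => by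
    rw [hχ]; by_cases h : s ∈ timeCell T N n <;> simp [h]
  have hmul : ∀ f : ℝ → ℝ, IntervalIntegrable f volume 0 τ →
      IntervalIntegrable (fun s => χ s * f s) volume 0 τ := by
    intro f hf
    rw [intervalIntegrable_iff_integrableOn_Ioc_of_le hτ] at hf ⊢
    exact Integrable.bdd_mul (c := 1) hf hχm.aestronglyMeasurable
      (Filter.Eventually.of_forall fun s => by
        rw [Real.norm_eq_abs, abs_of_nonneg (hχ01 s).1]; exact (hχ01 s).2)
  set w := ∫ s in (0 : ℝ)..τ, χ s * K s with hw
  set A := ∫ s in (0 : ℝ)..τ, χ s * K s ^ 2 with hA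
  have hχint : ∫ s in (0 : ℝ)..τ, χ s ≤ T / N := by
    rw [intervalIntegral.integral_of_le hτ]
    have hmeas : volume.real (timeCell T N n) = T / N := by
      rw [timeCell, Real.volume_real_Ioo_of_le (by nlinarith)]; ring
    calc ∫ s in Ioc 0 τ, χ s ≤ ∫ s, χ s := by
          refine setIntegral_le_integral ?_ (Filter.Eventually.of_forall fun s => (hχ01 s).1)
          rw [hχ, integrable_indicator_iff (measurableSet_timeCell T n)]
          exact integrableOn_const (by simp [timeCell])
      _ = T / N := by rw [hχ, integral_indicator_one (measurableSet_timeCell T n), hmeas]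
  -- `0 ≤ ∫ χ (K - α)²` with `α` the cell average of `K`
  set α := w / (T / N) with hα
  have h0 : 0 ≤ ∫ s in (0 : ℝ)..τ, χ s * (K s - α) ^ 2 :=
    intervalIntegral.integral_nonneg hτ fun s _ => mul_nonneg (hχ01 s).1 (sq_nonneg _)
  have e : ∀ s, χ s * (K s - α) ^ 2
      = (χ s * K s ^ 2 - 2 * α * (χ s * K s)) + α ^ 2 * χ s := fun s => by ring
  simp only [e] at h0
  rw [intervalIntegral.integral_add (((hmul _ hK2).sub ((hmul _ hK).const_mul _)))
    (hχi.const_mul _), intervalIntegral.integral_sub (hmul _ hK2) ((hmul _ hK).const_mul _),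
    intervalIntegral.integral_const_mul, intervalIntegral.integral_const_mul, ← hw, ← hA] at h0
  have h1 : α ^ 2 * ∫ s in (0 : ℝ)..τ, χ s ≤ α ^ 2 * (T / N) :=
    mul_le_mul_of_nonneg_left hχint (sq_nonneg _)
  have hαw : α * (T / N) = w := by rw [hα]; field_simp
  have h2 : α * w ≤ A := by
    have : α ^ 2 * (T / N) = α * w := by rw [← hαw]; ring
    linarith
  calc w ^ 2 = T / N * (α * w) := by rw [← hαw]; ring
    _ ≤ T / N * A := mul_le_mul_of_nonneg_left h2 hd.le

theorem sum_integral_timeCell_mul_le {T : ℝ} (hT : 0 < T) (N : ℕ) {τ : ℝ} (hτ : 0 ≤ τ)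
    {f : ℝ → ℝ} (hf0 : ∀ s, 0 ≤ f s) (hf : IntervalIntegrable f volume 0 τ) :
    ∑ n : Fin N, ∫ s in (0 : ℝ)..τ, (timeCell T N n).indicator 1 s * f s
      ≤ ∫ s in (0 : ℝ)..τ, f s := by
  have hi : ∀ n : Fin N, IntervalIntegrable
      (fun s => (timeCell T N n).indicator (1 : ℝ → ℝ) s * f s) volume 0 τ := by
    intro n
    rw [intervalIntegrable_iff_integrableOn_Ioc_of_le hτ] at hf ⊢
    refine Integrable.bdd_mul (c := 1) hf
      (measurable_one.indicator measurableSet_Ioo).aestronglyMeasurable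
      (Filter.Eventually.of_forall fun s => ?_)
    by_cases h : s ∈ timeCell T N n <;> simp [h]
  rw [← intervalIntegral.integral_finsetSum fun n _ => hi n]
  refine intervalIntegral.integral_mono_on hτ (by
    simpa only [Finset.sum_fn] using IntervalIntegrable.sum Finset.univ fun n _ => hi n) hf
    fun s _ => ?_
  by_cases h : ∃ n : Fin N, s ∈ timeCell T N n
  · obtain ⟨n, hn⟩ := h
    rw [Finset.sum_eq_single n]
    · rw [indicator_of_mem hn, Pi.one_apply, one_mul]
    · intro n' _ hne
      rw [indicator_of_notMem (s := timeCell T N n')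
        (Set.disjoint_right.mp (disjoint_timeCell hT hne) hn), zero_mul]
    · simp
  · push Not at h
    rw [Finset.sum_eq_zero fun n _ => by rw [indicator_of_notMem (h n), zero_mul]]
    exact hf0 s

/-- The modal error is a linear functional of the white noise, evaluated at a projection of
`-λ_k K(s) √2 cos (λ_k x)`. -/
theorem sum_forceCoef_mul {Ω : Type*} {T : ℝ} {W : Lp ℝ 2 (cylinder T) → Ω → ℝ} {J : ℕ} (hJ : 1 ≤ J) (N k : ℕ) (w : Fin N → ℝ) (ω : Ω) :
    ∑ n, forceCoef W N J k ω n * w n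
      = ∑ p : Fin N × Fin (J + 1), (-lam k * (w p.1 / (T / N)) * projCoef J k p.2)
        * cellNoise W N J p.1 p.2 ω := by
  rw [Fintype.sum_prod_type]
  refine Finset.sum_congr rfl fun n _ => ?_
  simp only [forceCoef, noiseCoef, integral_deriv_hat_mul_eps hJ, projCoef, Finset.mul_sum,
    Finset.sum_mul]
  rw [Finset.sum_comm]
  exact Finset.sum_congr rfl fun m _ => Finset.sum_congr rfl fun l _ => by ring

variable {Ω : Type*} [MeasurableSpace Ω] {P : Measure Ω} {T : ℝ}
  {W : Lp ℝ 2 (cylinder T) → Ω → ℝ}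

theorem memLp_sum_forceCoef_mul (hW : IsWhiteNoise P T W) {J : ℕ} (hJ : 1 ≤ J) (N k : ℕ)
    (w : Fin N → ℝ) : MemLp (fun ω => ∑ n, forceCoef W N J k ω n * w n) 2 P := by
  simp only [sum_forceCoef_mul hJ]
  exact memLp_finsetSum _ fun p _ => (hW.memLp _).const_mul _

theorem integral_sq_sum_forceCoef_le (hT : 0 < T) (hW : IsWhiteNoise P T W) {J : ℕ} (hJ : 1 ≤ J)
    (N k : ℕ) {τ : ℝ} (hτ : 0 ≤ τ) {K : ℝ → ℝ} (hK : IntervalIntegrable K volume 0 τ)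
    (hK2 : IntervalIntegrable (fun s => K s ^ 2) volume 0 τ) :
    ∫ ω, (∑ n, forceCoef W N J k ω n
        * ∫ s in (0 : ℝ)..τ, (timeCell T N n).indicator 1 s * K s) ^ 2 ∂P
      ≤ 2 * lam k ^ 2 * ∫ s in (0 : ℝ)..τ, K s ^ 2 := by
  set w : Fin N → ℝ := fun n => ∫ s in (0 : ℝ)..τ, (timeCell T N n).indicator 1 s * K s with hw
  set Q := ∑ i, ∑ j, projCoef J k i * projCoef J k j * gram J i j with hQ
  simp only [sum_forceCoef_mul hJ, cellNoise]
  rw [hW.integral_sum_sq]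
  simp only [Fintype.sum_prod_type, inner_cellHat hT]
  have e : ∀ n : Fin N, ∑ i : Fin (J + 1), ∑ n' : Fin N, ∑ j : Fin (J + 1),
      -lam k * (w n / (T / N)) * projCoef J k i * (-lam k * (w n' / (T / N)) * projCoef J k j)
        * (if n = n' then T / N * gram J i j else 0)
      = lam k ^ 2 * (w n ^ 2 / (T / N)) * Q := by
    intro n
    have hN : (0 : ℝ) < N := by exact_mod_cast n.pos
    rw [hQ, Finset.mul_sum]
    refine Finset.sum_congr rfl fun i _ => ?_
    rw [Finset.sum_eq_single n, Finset.mul_sum]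
    · refine Finset.sum_congr rfl fun j _ => ?_
      rw [if_pos rfl]
      field_simp
    · intro n' _ hne
      simp [hne.symm]
    · simp
  refine (Finset.sum_congr rfl fun n _ => e n).trans_le ?_
  rw [← Finset.sum_mul, ← Finset.mul_sum]
  have h1 : ∀ n : Fin N, w n ^ 2 / (T / N)
      ≤ ∫ s in (0 : ℝ)..τ, (timeCell T N n).indicator 1 s * K s ^ 2 := by
    intro n
    have hN : (0 : ℝ) < N := by exact_mod_cast n.pos
    rw [div_le_iff₀' (by positivity)]
    exact sq_integral_timeCell_mul_le hT n hτ hK hK2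
  have h2 : ∑ n : Fin N, w n ^ 2 / (T / N) ≤ ∫ s in (0 : ℝ)..τ, K s ^ 2 :=
    (Finset.sum_le_sum fun n _ => h1 n).trans
      (sum_integral_timeCell_mul_le hT N hτ (fun s => sq_nonneg (K s)) hK2)
  have h3 : 0 ≤ ∑ n : Fin N, w n ^ 2 / (T / N) :=
    Finset.sum_nonneg fun n _ => div_nonneg (sq_nonneg _) (by positivity)
  have hQ2 : Q ≤ 2 := sum_projCoef_mul_gram_le J k
  calc lam k ^ 2 * (∑ n : Fin N, w n ^ 2 / (T / N)) * Q
      ≤ lam k ^ 2 * (∑ n : Fin N, w n ^ 2 / (T / N)) * 2 :=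
        mul_le_mul_of_nonneg_left hQ2 (mul_nonneg (sq_nonneg _) h3)
    _ = 2 * lam k ^ 2 * ∑ n : Fin N, w n ^ 2 / (T / N) := by ring
    _ ≤ _ := mul_le_mul_of_nonneg_left h2 (by positivity)

end

/-! ### Summation over the modes -/

section

variable {Ω : Type*} [MeasurableSpace Ω] {P : Measure Ω}

/-- A random element of `L²(D)` is controlled by its sine coefficients; its measurability comes
from that of the coefficients, as it is almost surely the limit of its partial sine sums. -/
theorem memLp_and_integral_norm_sq_le (X : Ω → L2D) (E : ℕ → Ω → ℝ) (hE : ∀ k, MemLp (E k) 2 P)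
    (hX : ∀ᵐ ω ∂P, ∀ k, ⟪sineLp k, X ω⟫ = E k ω) {S : ℝ}
    (hS : ∀ n, ∑ k ∈ Finset.range n, ∫ ω, E k ω ^ 2 ∂P ≤ S) :
    MemLp X 2 P ∧ ∫ ω, ‖X ω‖ ^ 2 ∂P ≤ S := by
  have hXm : AEStronglyMeasurable X P := by
    refine aestronglyMeasurable_of_tendsto_ae Filter.atTop
      (f := fun n ω => ∑ k ∈ Finset.range n, E k ω • sineLp k) (fun n => ?_) ?_
    · exact Finset.aestronglyMeasurable_fun_sum _ fun k _ =>
        (hE k).aestronglyMeasurable.smul_const _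
    · filter_upwards [hX] with ω hω
      have := (hasSum_inner_sineLp_smul (X ω)).tendsto_sum_nat
      simpa only [hω] using this
  have hE2 : ∀ k, Integrable (fun ω => E k ω ^ 2) P := fun k => (hE k).integrable_sq
  have hnn : ∀ k, 0 ≤ ∫ ω, E k ω ^ 2 ∂P := fun k => integral_nonneg fun ω => sq_nonneg _
  have hsum := summable_of_sum_range_le hnn hS
  have hS' : ∑' k, ∫ ω, E k ω ^ 2 ∂P ≤ S := Real.tsum_le_of_sum_range_le hnn hS
  have hle : ∫⁻ ω, ENNReal.ofReal (‖X ω‖ ^ 2) ∂P ≤ ENNReal.ofReal S := by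
    calc ∫⁻ ω, ENNReal.ofReal (‖X ω‖ ^ 2) ∂P
        = ∫⁻ ω, ∑' k, ENNReal.ofReal (E k ω ^ 2) ∂P := by
          refine lintegral_congr_ae ?_
          filter_upwards [hX] with ω hω
          have h := hasSum_sq_inner_sineLp (X ω)
          simp only [hω] at h
          rw [← h.tsum_eq, ENNReal.ofReal_tsum_of_nonneg (fun k => sq_nonneg _) h.summable]
      _ = ∑' k, ∫⁻ ω, ENNReal.ofReal (E k ω ^ 2) ∂P :=
          lintegral_tsum fun k => (hE2 k).aestronglyMeasurable.aemeasurable.ennreal_ofReal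
      _ = ∑' k, ENNReal.ofReal (∫ ω, E k ω ^ 2 ∂P) := by
          refine tsum_congr fun k => ?_
          rw [ofReal_integral_eq_lintegral_ofReal (hE2 k)
            (Filter.Eventually.of_forall fun ω => sq_nonneg _)]
      _ = ENNReal.ofReal (∑' k, ∫ ω, E k ω ^ 2 ∂P) :=
          (ENNReal.ofReal_tsum_of_nonneg hnn hsum).symm
      _ ≤ ENNReal.ofReal S := ENNReal.ofReal_le_ofReal hS'
  have hX2m : AEStronglyMeasurable (fun ω => ‖X ω‖ ^ 2) P := hXm.norm.pow 2
  have hX2 : Integrable (fun ω => ‖X ω‖ ^ 2) P := by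
    refine ⟨hX2m, ?_⟩
    rw [hasFiniteIntegral_iff_ofReal (Filter.Eventually.of_forall fun ω => sq_nonneg _)]
    exact hle.trans_lt ENNReal.ofReal_lt_top
  refine ⟨(memLp_two_iff_integrable_sq_norm hXm).mpr hX2, ?_⟩
  rw [integral_eq_lintegral_of_nonneg_ae (Filter.Eventually.of_forall fun ω => sq_nonneg _) hX2m]
  exact ENNReal.toReal_le_of_le_ofReal ((hnn 0).trans (by simpa using hS 1)) hle

end

theorem sum_range_one_div_sq_le {A : ℝ} (hA : 0 < A) (n : ℕ) :
    ∑ k ∈ Finset.range n, 1 / ((k + 1 : ℕ) + A) ^ 2 ≤ 1 / A := by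
  have h : ∀ k : ℕ, 1 / (((k + 1 : ℕ) : ℝ) + A) ^ 2
      ≤ 1 / ((k : ℝ) + A) - 1 / (((k + 1 : ℕ) : ℝ) + A) := by
    intro k
    have h1 : (0 : ℝ) < k + A := by positivity
    push_cast
    rw [div_sub_div _ _ h1.ne' (by positivity), div_le_div_iff₀ (by positivity) (by positivity)]
    nlinarith
  refine (Finset.sum_le_sum fun k _ => h k).trans ?_
  rw [Finset.sum_range_sub' (fun k : ℕ => 1 / ((k : ℝ) + A))]
  have : 0 ≤ 1 / ((n : ℝ) + A) := by positivity
  rw [Nat.cast_zero, zero_add]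
  linarith

/-- With `A = d^{-1/4}`, the balance point of `d` and `k⁻⁴`, the bounds `I ≤ C d` and
`I ≤ C λ_k⁻⁴` combine to `λ_k² I ≤ 4 C / (k + A)²`. -/
theorem lam_sq_mul_le {C d A I : ℝ} (hC : 0 < C) (hA : 0 < A) (hdA : d * A ^ 4 = 1) (hI : 0 ≤ I)
    {k : ℕ} (h1 : I ≤ C * d) (h2 : lam k ^ 4 * I ≤ C) :
    lam k ^ 2 * I ≤ 4 * C * (1 / (k + A) ^ 2) := by
  rcases k.eq_zero_or_pos with rfl | hk
  · simp only [lam, Nat.cast_zero, zero_mul]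
    rw [zero_pow two_ne_zero, zero_mul]
    positivity
  have hk0 : (0 : ℝ) < k := by exact_mod_cast hk
  have hkl : (k : ℝ) ≤ lam k := by
    rw [lam]; nlinarith [Real.pi_gt_three]
  have b1 : lam k ^ 2 * I * A ^ 2 ≤ C := by
    refine le_of_sq_le_sq ?_ hC.le
    calc (lam k ^ 2 * I * A ^ 2) ^ 2 = (lam k ^ 4 * I) * (I * A ^ 4) := by ring
      _ ≤ C * (C * d * A ^ 4) :=
          mul_le_mul h2 (mul_le_mul_of_nonneg_right h1 (by positivity)) (by positivity) hC.le
      _ = C ^ 2 := by rw [mul_assoc C d, hdA]; ring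
  have b2 : lam k ^ 2 * I * k ^ 2 ≤ C := by
    refine le_trans ?_ h2
    have : (k : ℝ) ^ 2 ≤ lam k ^ 2 := pow_le_pow_left₀ hk0.le hkl 2
    calc lam k ^ 2 * I * k ^ 2 ≤ lam k ^ 2 * I * lam k ^ 2 :=
          mul_le_mul_of_nonneg_left this (by positivity)
      _ = lam k ^ 4 * I := by ring
  rw [mul_one_div, le_div_iff₀ (by positivity)]
  have h3 : ((k : ℝ) + A) ^ 2 ≤ 2 * k ^ 2 + 2 * A ^ 2 := by nlinarith [sq_nonneg ((k : ℝ) - A)]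
  have h4 : 0 ≤ lam k ^ 2 * I := by positivity
  nlinarith [mul_le_mul_of_nonneg_left h3 h4]

theorem rpow_le_omegaOne_mul {d ε : ℝ} (hd : 0 < d) (hε : 0 < ε) :
    d ^ (1 / 8 : ℝ) ≤ omegaOne d ε * d ^ (1 / 8 - ε) := by
  have h1 : d ^ ε ≤ omegaOne d ε := by
    have hb : (1 : ℝ) ≤ (1 + d ^ (7 / 4 : ℝ) + d ^ (3 / 4 : ℝ)) ^ (1 / 2 : ℝ) := by
      refine Real.one_le_rpow ?_ (by norm_num)
      have : 0 < d ^ (7 / 4 : ℝ) := by positivity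
      have : 0 < d ^ (3 / 4 : ℝ) := by positivity
      linarith
    have h0 : 0 < ε ^ (-(1 / 2) : ℝ) := by positivity
    have h2 : 0 < d ^ ε := by positivity
    rw [omegaOne]
    nlinarith
  calc d ^ (1 / 8 : ℝ) = d ^ ε * d ^ (1 / 8 - ε) := by rw [← Real.rpow_add hd]; ring_nf
    _ ≤ _ := mul_le_mul_of_nonneg_right h1 (by positivity)

section

variable {Ω : Type*} [MeasurableSpace Ω] {P : Measure Ω} {T : ℝ}
  {W : Lp ℝ 2 (cylinder T) → Ω → ℝ}

theorem continuousOn_inner_sineLp {u : ℝ → L2D} {s : Set ℝ} (hu : ContinuousOn u s) (k : ℕ) :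
    ContinuousOn (fun t => ⟪sineLp k, u t⟫) s :=
  continuousOn_const.inner hu

/-- Path by path, both the solution and the scheme are driven by the same step function, so each
sine coefficient of the error is a linear combination of its values on the time cells. -/
theorem inner_sineLp_error {μ : ℝ} {N J M : ℕ} (hJ : 1 ≤ J) (hd : 0 < T / M)
    {u : ℝ → Ω → L2D} (hu : IsRegSolution P W μ N J u)
    {U : ℕ → Ω → L2D} (hU : IsBackwardEuler P W μ N J M U) {m : ℕ} (hm : m ≤ M)
    (hmT : m * (T / M) ≤ T) (hne : ∀ k, 1 + T / M * symb μ (k + 1) ≠ 0) :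
    ∀ᵐ ω ∂P, ∀ k, ⟪sineLp k, U m ω - u (m * (T / M)) ω⟫
      = ∑ n : Fin N, forceCoef W N J (k + 1) ω n * ∫ s in (0 : ℝ)..(m * (T / M)),
        (timeCell T N n).indicator 1 s * errorKernel (symb μ (k + 1)) (T / M) (m * (T / M) - s) := by
  filter_upwards [hu, hU] with ω hu hU k
  obtain ⟨huc, -, hueq⟩ := hu
  obtain ⟨hU0, hUeq⟩ := hU
  rw [inner_sub_right]
  refine duhamel_error (V := fun j => ⟪sineLp k, U j ω⟫) (y := fun t => ⟪sineLp k, u t ω⟫)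
    hd (hne k) (forceCoef W N J (k + 1) ω) (continuousOn_inner_sineLp huc k) ?_ (by simp [hU0])
    ?_ hm hmT
  · intro t ht
    have h := hueq _ (isTestFunction_eps (k + 1)) t ht
    simp only [integral_dxRegNoise_mul_eps W hJ] at h
    rw [← h]
    simp only [inner_sineLp]
    congr 1
    rw [← intervalIntegral.integral_const_mul]
    congr 1
    funext s
    rw [iteratedDeriv_four_eps, iteratedDeriv_two_eps, ← integral_const_mul]
    congr 1
    funext x
    rw [symb]
    ring
  · intro j hj
    obtain ⟨f, hf, hae⟩ := hUeq j hj
    have h1 : ⟪sineLp k, U (j + 1) ω - U j ω + (T / M) • f⟫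
        = ∫ x in D, (∫ s in ((j : ℝ) * (T / M))..(((j : ℝ) + 1) * (T / M)),
          dxRegNoise W N J ω s x) * eps (k + 1) x := by
      rw [inner_sineLp]
      refine integral_congr_ae ?_
      filter_upwards [hae, Lp.coeFn_add (U (j + 1) ω - U j ω) ((T / M) • f),
        Lp.coeFn_sub (U (j + 1) ω) (U j ω), Lp.coeFn_smul (T / M) f] with x e1 e2 e3 e4
      rw [e2, Pi.add_apply, e3, Pi.sub_apply, e4, Pi.smul_apply, smul_eq_mul, e1]
    rw [integral_integral_dxRegNoise_mul_eps W hJ, inner_add_right, inner_sub_right,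
      inner_smul_right, inner_sineLp_of_isLambdaB hf] at h1
    exact h1

end

end CahnHilliardCook

theorem theorem4p1 {Ω : Type*} [MeasurableSpace Ω] (P : Measure Ω) [IsProbabilityMeasure P]
    (T : ℝ) (hT : 0 < T)
    (W : Lp ℝ 2 (cylinder T) → Ω → ℝ) (hW : IsWhiteNoise P T W)
    (μ : ℝ) (κ : ℕ) (hκ : 1 ≤ κ)
    (hμ_lower : ((κ : ℝ) - 1) ^ 2 * Real.pi ^ 2 ≤ μ)
    (hμ_upper : μ < (κ : ℝ) ^ 2 * Real.pi ^ 2) :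
    ∃ C : ℝ, 0 < C ∧
      ∀ N J M : ℕ, 1 ≤ N → 1 ≤ J → 1 ≤ M →
        (κ = 1 ∨ (2 ≤ κ ∧ T / M * μ ^ 2 < 1 / 4)) →
        ∀ u : ℝ → Ω → L2D, IsRegSolution P W μ N J u →
        ∀ U : ℕ → Ω → L2D, IsBackwardEuler P W μ N J M U →
        ∀ m : ℕ, 1 ≤ m → m ≤ M →
          MemLp (fun ω => U m ω - u ((m : ℝ) * (T / M)) ω) 2 P ∧
          ∀ ε ∈ Ioc (0 : ℝ) (1 / 8),
            (∫ ω, ‖U m ω - u ((m : ℝ) * (T / M)) ω‖ ^ 2 ∂P) ^ (1 / 2 : ℝ)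
              ≤ C * omegaOne (T / M) ε * (T / M) ^ (1 / 8 - ε) := by
  obtain ⟨C, hC, hbound⟩ := exists_errorKernel_bound hT hκ hμ_lower hμ_upper
  refine ⟨(8 * C) ^ (1 / 2 : ℝ), by positivity, ?_⟩
  intro N J M _ hJ hM hcond u hu U hU m _ hm
  have hM0 : (0 : ℝ) < M := by exact_mod_cast hM
  have hd : 0 < T / M := by positivity
  have hmT : (m : ℝ) * (T / M) ≤ T := by
    calc (m : ℝ) * (T / M) ≤ M * (T / M) :=
          mul_le_mul_of_nonneg_right (by exact_mod_cast hm) hd.le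
      _ = T := by field_simp
  have hmd : 0 ≤ (m : ℝ) * (T / M) := by positivity
  have hb := hbound M hM hcond
  have hX := inner_sineLp_error hJ hd hu hU hm hmT fun k => (hb (k + 1) m (by omega) hm).1
  set d := T / M
  set A := d ^ (-(1 / 4) : ℝ) with hA
  have hA0 : 0 < A := by positivity
  have hdA : d * A ^ 4 = 1 := by
    rw [hA, ← Real.rpow_natCast, ← Real.rpow_mul hd.le]
    norm_num
    rw [Real.rpow_neg_one, mul_inv_cancel₀ hd.ne']
  have hmode : ∀ k, ∫ ω, (∑ n : Fin N, forceCoef W N J (k + 1) ω n * ∫ s in (0 : ℝ)..(m * d),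
      (timeCell T N n).indicator 1 s * errorKernel (symb μ (k + 1)) d (m * d - s)) ^ 2 ∂P
      ≤ 8 * C * (1 / ((k + 1 : ℕ) + A) ^ 2) := by
    intro k
    obtain ⟨-, h1, h2⟩ := hb (k + 1) m (by omega) hm
    have hK2 := intervalIntegrable_errorKernel_sq (symb μ (k + 1)) hd m
    have hsub : ∀ f : ℝ → ℝ, IntervalIntegrable f volume 0 (m * d) →
        IntervalIntegrable (fun s => f (m * d - s)) volume 0 (m * d) := fun f hf => by
      simpa using (hf.comp_sub_left (m * d)).symm
    have hK := intervalIntegrable_errorKernel (symb μ (k + 1)) hd m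
    have h3 := integral_sq_sum_forceCoef_le hT hW hJ N (k + 1) hmd (hsub _ hK) (hsub _ hK2)
    have h4 : ∫ s in (0 : ℝ)..(m * d), errorKernel (symb μ (k + 1)) d (m * d - s) ^ 2
        = ∫ σ in (0 : ℝ)..(m * d), errorKernel (symb μ (k + 1)) d σ ^ 2 := by
      rw [intervalIntegral.integral_comp_sub_left
        (fun σ => errorKernel (symb μ (k + 1)) d σ ^ 2)]
      simp
    rw [h4] at h3
    have h5 := lam_sq_mul_le hC hA0 hdA
      (intervalIntegral.integral_nonneg hmd fun σ _ => sq_nonneg _) h1 h2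
    refine h3.trans ?_
    linarith
  obtain ⟨hL, hI⟩ := memLp_and_integral_norm_sq_le _ _
    (fun k => memLp_sum_forceCoef_mul hW hJ N (k + 1) _) hX (S := 8 * C * (1 / A)) (by
      intro n
      refine (Finset.sum_le_sum fun k _ => hmode k).trans ?_
      rw [← Finset.mul_sum]
      exact mul_le_mul_of_nonneg_left (sum_range_one_div_sq_le hA0 n) (by positivity))
  refine ⟨hL, fun ε hε => ?_⟩
  have hAd : 1 / A = d ^ (1 / 4 : ℝ) := by
    rw [hA, Real.rpow_neg hd.le, one_div, inv_inv]
  calc (∫ ω, ‖U m ω - u ((m : ℝ) * d) ω‖ ^ 2 ∂P) ^ (1 / 2 : ℝ)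
      ≤ (8 * C * d ^ (1 / 4 : ℝ)) ^ (1 / 2 : ℝ) :=
        Real.rpow_le_rpow (integral_nonneg fun ω => sq_nonneg _) (hAd ▸ hI) (by norm_num)
    _ = (8 * C) ^ (1 / 2 : ℝ) * d ^ (1 / 8 : ℝ) := by
        rw [Real.mul_rpow (by positivity) (by positivity), ← Real.rpow_mul hd.le]
        norm_num
    _ ≤ (8 * C) ^ (1 / 2 : ℝ) * (omegaOne d ε * d ^ (1 / 8 - ε)) :=
        mul_le_mul_of_nonneg_left (rpow_le_omegaOne_mul hd hε.1) (by positivity)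
    _ = (8 * C) ^ (1 / 2 : ℝ) * omegaOne d ε * d ^ (1 / 8 - ε) := by ring
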